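/- Let $\zeta$ be the Riemann zeta function. Let $\alpha \in (1/2,1)$ and let $\tau$ be a real number with $$0 < \tau < \frac{(2\alpha-1)^{1-\alpha}}{6}.$$ Put $\beta = (6\tau)^{1/(1-\alpha)}$ and, for real $T > e$, let $$F_{\alpha,\tau} = F_{\alpha,\tau}(T) = \left\{ t \in [0,T] :\ |\zeta(\alpha+it)| \geq \exp\left( \frac{\tau (\log T)^{1-\alpha}}{(\log\log T)^{\alpha}} \right) \right\}.$$ Then $2\alpha-1-\beta > 0$, and there is a $T_0 = T_0(\alpha,\tau)$ such that for all real $T \geq T_0$ $$\operatorname{meas}(F_{\alpha,\tau}) \geq T^{2\alpha-1-\beta},$$ where $\operatorname{meas}$ denotes Lebesgue measure. -/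

import Mathlib

/-- The set `F_{α,τ}` (which also depends on `T`) of those `t ∈ [0,T]` for which
`|ζ(α+it)| ≥ exp (τ (log T)^{1-α} / (log log T)^α)`. -/
noncomputable def zetaLargeSet (α τ T : ℝ) : Set ℝ :=
  {t : ℝ | t ∈ Set.Icc 0 T ∧
    Real.exp (τ * (Real.log T) ^ (1 - α) / (Real.log (Real.log T)) ^ α) ≤
      ‖riemannZeta ((α : ℂ) + (t : ℂ) * Complex.I)‖}

/-- The exponent `β(τ) = (6τ)^{1/(1-α)}`. -/
noncomputable def zetaBeta (α τ : ℝ) : ℝ :=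
  (6 * τ) ^ (1 / (1 - α))

/-! The proof is the resonance method. Let P consist of about (β/2) log T primes up to y = β log T
log log T, let R(t) = ∏_{p ∈ P} (1 - p^{it}/2)⁻¹, and let w be the triangle function on [-T, T].
Then |R|² ≤ 4^|P| ≤ T^β.

Let F be the Fourier transform of w|R|². The transform of w is nonnegative and R has nonnegative
coefficients, so F ≥ 0; moreover the geometric series at p gives F(x - log p) ≥ F(x)/2. Integrate
∑_{k ≤ N} k^{-α-it} against w|R|² and keep only those k that are products of few distinct primes of
P: the result is at least roughly (1 + y^{-α}/2)^|P| F(0), with F(0) ≥ T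
(`sum_triangleFourier_resonator_ge`). For the chosen P the factor exceeds V = exp(τ (log T)^{1-α} /
(log log T)^α) by any prescribed constant (`eventually_exists_primes`).

With N ≈ T², ζ(α+it) is the partial sum plus a pole term plus O(1)
(`norm_riemannZeta_sub_zetaPartialSum_le`), so ∫ w|R|²|ζ| is equally large
(`integral_norm_zeta_mul_resonator_ge`). Where |ζ| < V the integrand contributes at most V F(0). The
excess, of order at least T, comes from the large values, where the integrand is O(T^β · T^{2-2α})
(`integral_norm_zeta_mul_resonator_le`). Dividing gives T^{2α-1-β}. -/

/-! ### Approximation of ζ by partial sums to the right of Re s = 0. -/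

/-- The `n`-th term of the series that represents `(s - 1) ζ(s)` minus its partial-sum
approximation: `(s - 1) ((n + 1)^{-s} - ∫_n^{n+1} u^{-s} du)`. -/
noncomputable def zetaTailTerm (n : ℕ) (s : ℂ) : ℂ :=
  (s - 1) * ((n + 1 : ℕ) : ℂ) ^ (-s) + ((n + 1 : ℕ) : ℂ) ^ (1 - s) - (n : ℂ) ^ (1 - s)

/-- The partial sum `∑_{k = 1}^{N} k^{-s}`. -/
noncomputable def zetaPartialSum (N : ℕ) (s : ℂ) : ℂ :=
  ∑ k ∈ Finset.range N, ((k + 1 : ℕ) : ℂ) ^ (-s)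

lemma norm_cpow_neg_sub_cpow_neg_le {n : ℕ} (hn : 1 ≤ n) {s : ℂ} (hs : 0 < s.re) {u : ℝ}
    (hu : u ∈ Set.Icc (n : ℝ) (n + 1)) :
    ‖((n + 1 : ℝ) : ℂ) ^ (-s) - (u : ℂ) ^ (-s)‖ ≤ ‖s‖ * (n : ℝ) ^ (-s.re - 1) := by
  have hn0 : (0 : ℝ) < n := by exact_mod_cast hn
  have hs0 : -s ≠ 0 := by
    intro h
    have : s = 0 := by simpa using h
    simp [this] at hs
  have key := Convex.norm_image_sub_le_of_norm_hasDerivWithin_le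
    (f := fun y : ℝ => (y : ℂ) ^ (-s)) (f' := fun y : ℝ => -s * (y : ℂ) ^ (-s - 1))
    (s := Set.Icc (n : ℝ) (n + 1)) (x := u) (y := (n + 1 : ℝ))
    (C := ‖s‖ * (n : ℝ) ^ (-s.re - 1))
    (fun x hx => (hasDerivAt_ofReal_cpow_const (by linarith [hx.1]) hs0).hasDerivWithinAt)
    (fun x hx => by
      have hx0 : 0 < x := lt_of_lt_of_le hn0 hx.1
      rw [norm_mul, norm_neg, Complex.norm_cpow_eq_rpow_re_of_pos hx0]
      gcongr
      simp only [Complex.sub_re, Complex.neg_re, Complex.one_re]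
      exact Real.rpow_le_rpow_of_nonpos hn0 hx.1 (by linarith))
    (convex_Icc _ _) hu ⟨by linarith, le_rfl⟩
  refine key.trans ?_
  have h1 : ‖(n + 1 : ℝ) - u‖ ≤ 1 := by
    rw [Real.norm_eq_abs, abs_le]
    constructor <;> linarith [hu.1, hu.2]
  exact mul_le_of_le_one_right (by positivity) h1

lemma norm_zetaTailTerm_le {n : ℕ} (hn : 1 ≤ n) {s : ℂ} (hs : 0 < s.re) :
    ‖zetaTailTerm n s‖ ≤ ‖s - 1‖ * ‖s‖ * (n : ℝ) ^ (-s.re - 1) := by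
  have hn0 : (0 : ℝ) < n := by exact_mod_cast hn
  by_cases h1 : s = 1
  · simp [h1, zetaTailTerm]
  have hs1 : 1 - s ≠ 0 := sub_ne_zero.mpr (Ne.symm h1)
  -- The tail term is the increment over [n, n+1] of a function with derivative (s-1)((n+1)^{-s} -
  -- y^{-s}).
  have key := Convex.norm_image_sub_le_of_norm_hasDerivWithin_le
    (f := fun y : ℝ => (s - 1) * ((n + 1 : ℝ) : ℂ) ^ (-s) * (y : ℂ) + (y : ℂ) ^ (1 - s))
    (f' := fun y : ℝ => (s - 1) * ((n + 1 : ℝ) : ℂ) ^ (-s) * 1 + (1 - s) * (y : ℂ) ^ (1 - s - 1))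
    (s := Set.Icc (n : ℝ) (n + 1)) (x := (n : ℝ)) (y := (n + 1 : ℝ))
    (C := ‖s - 1‖ * ‖s‖ * (n : ℝ) ^ (-s.re - 1))
    (fun x hx => ((Complex.ofRealCLM.hasDerivAt.const_mul _).add
      (hasDerivAt_ofReal_cpow_const (by linarith [hx.1]) hs1)).hasDerivWithinAt)
    (fun x hx => by
      have : (s - 1) * ((n + 1 : ℝ) : ℂ) ^ (-s) * 1 + (1 - s) * (x : ℂ) ^ (1 - s - 1)
          = (s - 1) * (((n + 1 : ℝ) : ℂ) ^ (-s) - (x : ℂ) ^ (-s)) := by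
        rw [show 1 - s - 1 = -s by ring]; ring
      rw [this, norm_mul, mul_assoc]
      gcongr
      exact norm_cpow_neg_sub_cpow_neg_le hn hs hx)
    (convex_Icc _ _) ⟨le_rfl, by linarith⟩ ⟨by linarith, le_rfl⟩
  have e : zetaTailTerm n s =
      ((s - 1) * ((n + 1 : ℝ) : ℂ) ^ (-s) * ((n + 1 : ℝ) : ℂ) + ((n + 1 : ℝ) : ℂ) ^ (1 - s)) -
      ((s - 1) * ((n + 1 : ℝ) : ℂ) ^ (-s) * ((n : ℝ) : ℂ) + ((n : ℝ) : ℂ) ^ (1 - s)) := by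
    rw [zetaTailTerm]; push_cast; ring
  rw [e]
  simpa using key

/-- By the mean value theorem the difference is σ c^{-σ-1} with n < c < n+1 ≤ 2n, and 2^{-σ-1} ≥ 1/4
because σ ≤ 1. -/
lemma rpow_neg_sub_one_le_telescope {n : ℕ} (hn : 1 ≤ n) {σ : ℝ} (h0 : 0 < σ) (h1 : σ ≤ 1) :
    (n : ℝ) ^ (-σ - 1) ≤ 4 / σ * ((n : ℝ) ^ (-σ) - ((n + 1 : ℕ) : ℝ) ^ (-σ)) := by
  have hn0 : (0 : ℝ) < n := by exact_mod_cast hn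
  have hn1 : (1 : ℝ) ≤ n := by exact_mod_cast hn
  obtain ⟨c, hc, hc'⟩ := exists_hasDerivAt_eq_slope (fun x : ℝ => x ^ (-σ))
    (fun x => -σ * x ^ (-σ - 1)) (show (n : ℝ) < n + 1 by linarith)
    (continuousOn_of_forall_continuousAt fun x hx =>
      (Real.hasDerivAt_rpow_const (Or.inl (by linarith [hx.1]))).continuousAt)
    (fun x hx => Real.hasDerivAt_rpow_const (Or.inl (by linarith [hx.1])))
  have h2 : (2 * n : ℝ) ^ (-σ - 1) ≤ c ^ (-σ - 1) :=
    Real.rpow_le_rpow_of_nonpos (by linarith [hc.1]) (by linarith [hc.2]) (by linarith)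
  have h3 : (1 / 4 : ℝ) ≤ (2 : ℝ) ^ (-σ - 1) := by
    calc (1 / 4 : ℝ) = (2 : ℝ) ^ (-2 : ℝ) := by
          rw [Real.rpow_neg (by norm_num)]; norm_num
      _ ≤ _ := Real.rpow_le_rpow_of_exponent_le (by norm_num) (by linarith)
  rw [Real.mul_rpow (by norm_num) hn0.le] at h2
  have hp : (0 : ℝ) < (n : ℝ) ^ (-σ - 1) := by positivity
  have h4 : (n : ℝ) ^ (-σ) - ((n + 1 : ℕ) : ℝ) ^ (-σ) = σ * c ^ (-σ - 1) := by
    have : (n + 1 : ℝ) - n = 1 := by ring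
    rw [this, div_one] at hc'
    push_cast
    linarith
  rw [h4, ← mul_assoc, div_mul_cancel₀ _ h0.ne']
  nlinarith

lemma sum_rpow_neg_sub_one_le {N : ℕ} (hN : 1 ≤ N) {σ : ℝ} (h0 : 0 < σ) (h1 : σ ≤ 1) (m : ℕ) :
    ∑ j ∈ Finset.range m, ((N + j : ℕ) : ℝ) ^ (-σ - 1) ≤ 4 / σ * (N : ℝ) ^ (-σ) := by
  calc _ ≤ ∑ j ∈ Finset.range m,
        4 / σ * (((N + j : ℕ) : ℝ) ^ (-σ) - ((N + j + 1 : ℕ) : ℝ) ^ (-σ)) :=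
        Finset.sum_le_sum fun j _ => rpow_neg_sub_one_le_telescope (by omega) h0 h1
    _ = 4 / σ * (((N + 0 : ℕ) : ℝ) ^ (-σ) - ((N + m : ℕ) : ℝ) ^ (-σ)) := by
        rw [← Finset.mul_sum]
        congr 1
        exact Finset.sum_range_sub' (fun j => ((N + j : ℕ) : ℝ) ^ (-σ)) m
    _ ≤ _ := by
        have : (0 : ℝ) ≤ ((N + m : ℕ) : ℝ) ^ (-σ) := by positivity
        gcongr
        simpa using this

lemma differentiable_natCast_cpow {n : ℕ} (hn : 1 ≤ n) {f : ℂ → ℂ} (hf : Differentiable ℂ f) :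
    Differentiable ℂ fun s => (n : ℂ) ^ f s :=
  hf.const_cpow (Or.inl (by exact_mod_cast (by omega : n ≠ 0)))

lemma differentiable_zetaTailTerm {n : ℕ} (hn : 1 ≤ n) : Differentiable ℂ (zetaTailTerm n) := by
  unfold zetaTailTerm
  exact (((differentiable_id.sub_const 1).mul
    (differentiable_natCast_cpow (by omega) differentiable_neg)).add
    (differentiable_natCast_cpow (by omega) (differentiable_id.const_sub 1))).sub
    (differentiable_natCast_cpow hn (differentiable_id.const_sub 1))

lemma differentiable_zetaPartialSum (N : ℕ) : Differentiable ℂ (zetaPartialSum N) := by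
  unfold zetaPartialSum
  exact Differentiable.fun_sum fun k _ =>
    differentiable_natCast_cpow (by omega) differentiable_neg

lemma sum_range_zetaTailTerm (N m : ℕ) (s : ℂ) :
    ∑ j ∈ Finset.range m, zetaTailTerm (N + j) s =
      (s - 1) * (zetaPartialSum (m + N) s - zetaPartialSum N s) +
        ((m + N : ℕ) : ℂ) ^ (1 - s) - (N : ℂ) ^ (1 - s) := by
  induction m with
  | zero => simp
  | succ m ih =>
    rw [Finset.sum_range_succ, ih, zetaTailTerm, show m + 1 + N = m + N + 1 by ring,
      add_comm N m]
    simp only [zetaPartialSum, Finset.sum_range_succ]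
    ring

lemma summable_zetaTailTerm {N : ℕ} (hN : 1 ≤ N) {s : ℂ} (hs : 0 < s.re) :
    Summable fun j => zetaTailTerm (N + j) s := by
  refine Summable.of_norm_bounded (g := fun j => ‖s - 1‖ * ‖s‖ * ((N + j : ℕ) : ℝ) ^ (-s.re - 1))
    (Summable.mul_left _ ?_) fun j => norm_zetaTailTerm_le (by omega) hs
  have := (summable_nat_add_iff N).mpr (Real.summable_nat_rpow (p := -s.re - 1) |>.mpr (by linarith))
  simpa [add_comm] using this

lemma riemannZeta_mul_eq_of_one_lt_re {N : ℕ} (hN : 1 ≤ N) {s : ℂ} (hs : 1 < s.re) :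
    (s - 1) * riemannZeta s = (s - 1) * zetaPartialSum N s + (N : ℂ) ^ (1 - s) +
      ∑' j, zetaTailTerm (N + j) s := by
  have h1 := (summable_zetaTailTerm hN (s := s) (by linarith)).hasSum.tendsto_sum_nat
  simp_rw [sum_range_zetaTailTerm] at h1
  have h2 : Filter.Tendsto (fun m => zetaPartialSum m s) Filter.atTop (nhds (riemannZeta s)) := by
    rw [zeta_eq_tsum_one_div_nat_add_one_cpow hs]
    have hsum : Summable fun n : ℕ => 1 / ((n : ℂ) + 1) ^ s := by
      have := (summable_nat_add_iff 1).mpr (Complex.summable_one_div_nat_cpow.mpr hs)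
      simpa using this
    refine hsum.hasSum.tendsto_sum_nat.congr fun m => ?_
    refine Finset.sum_congr rfl fun k _ => ?_
    rw [Complex.cpow_neg, one_div]
    push_cast; rfl
  have h3 : Filter.Tendsto (fun m : ℕ => (m : ℂ) ^ (1 - s)) Filter.atTop (nhds 0) := by
    rw [tendsto_zero_iff_norm_tendsto_zero]
    have := (tendsto_rpow_neg_atTop (y := s.re - 1) (by linarith)).comp
      tendsto_natCast_atTop_atTop
    refine this.congr' ?_
    filter_upwards [Filter.eventually_gt_atTop 0] with m hm
    rw [Complex.norm_natCast_cpow_of_pos hm]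
    simp
  have h4 := ((((Filter.tendsto_add_atTop_iff_nat N).mpr h2).sub_const
    (zetaPartialSum N s)).const_mul (s - 1)).add ((Filter.tendsto_add_atTop_iff_nat N).mpr h3)
      |>.sub_const ((N : ℂ) ^ (1 - s))
  have := tendsto_nhds_unique h1 h4
  rw [this]; ring

/-- Analytic continuation from a neighbourhood of 2. The region may contain 1, so the identity
theorem is applied to the entire function `riemannZeta₁`, which is (s-1)ζ(s) away from 1. -/
lemma riemannZeta_mul_eq_of_pos_re {N : ℕ} (hN : 1 ≤ N) {s : ℂ} (hs : 0 < s.re) (hs1 : s ≠ 1) :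
    (s - 1) * riemannZeta s = (s - 1) * zetaPartialSum N s + (N : ℂ) ^ (1 - s) +
      ∑' j, zetaTailTerm (N + j) s := by
  set M := ‖s‖ + 3
  obtain ⟨ε, hε, hεs, hε2⟩ : ∃ ε, 0 < ε ∧ ε < s.re ∧ ε < 2 :=
    ⟨min (s.re / 2) 1, by positivity, by linarith [min_le_left (s.re / 2) 1],
      by linarith [min_le_right (s.re / 2) 1]⟩
  -- The half-plane and the ball bound the tail terms uniformly by a summable sequence; convexity
  -- gives connectedness.
  let U : Set ℂ := {z | ε < z.re} ∩ Metric.ball 0 M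
  have hUo : IsOpen U := (isOpen_lt continuous_const Complex.continuous_re).inter Metric.isOpen_ball
  have hUc : Convex ℝ U := (convex_halfSpace_re_gt ε).inter (convex_ball 0 M)
  have h2U : (2 : ℂ) ∈ U := by
    refine ⟨by simpa using hε2, ?_⟩
    simp only [Metric.mem_ball, dist_zero_right, Complex.norm_ofNat, M]
    linarith [norm_nonneg s]
  have hsU : s ∈ U := ⟨hεs, by simp [M]⟩
  have hM : 0 < M := by positivity
  have htail : DifferentiableOn ℂ (fun z => ∑' j, zetaTailTerm (N + j) z) U := by
    refine Complex.differentiableOn_tsum_of_summable_norm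
      (u := fun j => (M + 1) * M * ((N + j : ℕ) : ℝ) ^ (-ε - 1)) ?_
      (fun j => (differentiable_zetaTailTerm (by omega)).differentiableOn) hUo ?_
    · refine Summable.mul_left _ ?_
      have := (summable_nat_add_iff N).mpr
        (Real.summable_nat_rpow (p := -ε - 1) |>.mpr (by linarith))
      simpa [add_comm] using this
    · intro j z hz
      have hz2 : ‖z‖ ≤ M := by simpa using (Metric.mem_ball.mp hz.2).le
      have hz1 : ε < z.re := hz.1
      refine (norm_zetaTailTerm_le (by omega) (by linarith)).trans ?_
      gcongr
      · exact (norm_sub_le _ _).trans (by simpa using hz2)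
      · exact_mod_cast (by omega : 1 ≤ N + j)
  have hR : AnalyticOnNhd ℂ (fun z => (z - 1) * zetaPartialSum N z + (N : ℂ) ^ (1 - z) +
      ∑' j, zetaTailTerm (N + j) z) U := by
    refine DifferentiableOn.analyticOnNhd ?_ hUo
    refine DifferentiableOn.add (Differentiable.differentiableOn ?_) htail
    exact ((differentiable_id.sub_const 1).mul (differentiable_zetaPartialSum N)).add
      (differentiable_natCast_cpow hN (differentiable_id.const_sub 1))
  have hL : AnalyticOnNhd ℂ riemannZeta₁ U :=
    differentiable_riemannZeta₁.differentiableOn.analyticOnNhd hUo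
  have h1 : ∀ z : ℂ, z ≠ 1 → (z - 1) * riemannZeta z = riemannZeta₁ z := by
    intro z hz
    rw [riemannZeta_eq_inv_sub_mul hz, mul_inv_cancel_left₀ (sub_ne_zero.mpr hz)]
  rw [h1 s hs1]
  refine hL.eqOn_of_preconnected_of_eventuallyEq hR hUc.isPreconnected h2U ?_ hsU
  filter_upwards [(isOpen_lt continuous_const Complex.continuous_re).mem_nhds
    (show (1 : ℝ) < (2 : ℂ).re by simp)] with z hz
  have hz' : 1 < z.re := hz
  rw [← h1 z (by rintro rfl; simp at hz'), riemannZeta_mul_eq_of_one_lt_re hN hz']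

/-- Approximation of `ζ` by its partial sums in the strip `0 < Re s ≤ 1`. -/
theorem norm_riemannZeta_sub_zetaPartialSum_le {N : ℕ} (hN : 1 ≤ N) {s : ℂ} (hs : 0 < s.re)
    (hs' : s.re ≤ 1) (hs1 : s ≠ 1) :
    ‖riemannZeta s - zetaPartialSum N s - (N : ℂ) ^ (1 - s) / (s - 1)‖ ≤
      4 / s.re * ‖s‖ * (N : ℝ) ^ (-s.re) := by
  have h1 : s - 1 ≠ 0 := sub_ne_zero.mpr hs1
  have h2 := riemannZeta_mul_eq_of_pos_re hN hs hs1
  have h3 : riemannZeta s - zetaPartialSum N s - (N : ℂ) ^ (1 - s) / (s - 1) =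
      (∑' j, zetaTailTerm (N + j) s) / (s - 1) := by
    field_simp
    linear_combination h2
  have hsum : Summable fun j => ‖s - 1‖ * ‖s‖ * ((N + j : ℕ) : ℝ) ^ (-s.re - 1) :=
    (summable_of_sum_range_le (fun j => by positivity)
      (sum_rpow_neg_sub_one_le hN hs hs')).mul_left _
  have h4 : ‖∑' j, zetaTailTerm (N + j) s‖ ≤
      ‖s - 1‖ * ‖s‖ * (4 / s.re * (N : ℝ) ^ (-s.re)) := by
    refine (tsum_of_norm_bounded hsum.hasSum fun j => norm_zetaTailTerm_le (by omega) hs).trans ?_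
    rw [tsum_mul_left]
    gcongr
    exact Real.tsum_le_of_sum_range_le (fun j => by positivity) (sum_rpow_neg_sub_one_le hN hs hs')
  rw [h3, norm_div, div_le_iff₀ (norm_pos_iff.mpr h1)]
  refine h4.trans (le_of_eq ?_)
  ring

lemma sum_range_rpow_neg_le {σ : ℝ} (h0 : 0 < σ) (h1 : σ < 1) (N : ℕ) :
    ∑ k ∈ Finset.range N, ((k + 1 : ℕ) : ℝ) ^ (-σ) ≤ (N : ℝ) ^ (1 - σ) / (1 - σ) := by
  have h1' : 0 < 1 - σ := by linarith
  induction N with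
  | zero => simp [Real.zero_rpow h1'.ne']
  | succ n ih =>
    rw [Finset.sum_range_succ]
    obtain ⟨c, hc, hc'⟩ := exists_hasDerivAt_eq_slope (fun x : ℝ => x ^ (1 - σ))
      (fun x => (1 - σ) * x ^ (1 - σ - 1)) (show (n : ℝ) < n + 1 by linarith)
      (continuousOn_of_forall_continuousAt fun x hx =>
        Real.continuousAt_rpow_const _ _ (Or.inr h1'.le))
      (fun x hx => Real.hasDerivAt_rpow_const
        (Or.inl (by linarith [hx.1, (Nat.cast_nonneg n : (0 : ℝ) ≤ n)])))
    have hc0 : 0 < c := lt_of_le_of_lt (Nat.cast_nonneg n) hc.1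
    have h2 : ((n + 1 : ℕ) : ℝ) ^ (-σ) ≤ c ^ (-σ) :=
      Real.rpow_le_rpow_of_nonpos hc0 (by push_cast; exact hc.2.le) (by linarith)
    rw [show (n + 1 : ℝ) - n = 1 by ring, div_one, show 1 - σ - 1 = -σ by ring] at hc'
    have h3 : ((n + 1 : ℕ) : ℝ) ^ (1 - σ) / (1 - σ) = (n : ℝ) ^ (1 - σ) / (1 - σ) + c ^ (-σ) := by
      push_cast
      field_simp
      linarith
    rw [h3]
    linarith

lemma norm_zetaPartialSum_le {s : ℂ} (hs : 0 < s.re) (hs' : s.re < 1) (N : ℕ) :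
    ‖zetaPartialSum N s‖ ≤ (N : ℝ) ^ (1 - s.re) / (1 - s.re) := by
  refine (norm_sum_le _ _).trans (le_trans (le_of_eq ?_) (sum_range_rpow_neg_le hs hs' N))
  refine Finset.sum_congr rfl fun k _ => ?_
  rw [Complex.norm_natCast_cpow_of_pos (by omega)]
  simp

/-! ### The triangle function and positivity of its Fourier transform. -/

/-- The triangle function `1 - |t| / T`. -/
noncomputable def triangleWeight (T t : ℝ) : ℝ := 1 - |t| / T

/-- The real part of the Fourier transform at `x` of the restriction to `[-T, T]` of `f` times the
triangle function. -/
noncomputable def triangleFourier (T : ℝ) (f : ℝ → ℂ) (x : ℝ) : ℝ :=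
  (∫ t in -T..T, (triangleWeight T t : ℂ) * f t * Complex.exp (x * t * Complex.I)).re

lemma continuous_triangleWeight (T : ℝ) : Continuous (triangleWeight T) := by
  unfold triangleWeight; fun_prop

lemma triangleWeight_nonneg {T t : ℝ} (hT : 0 < T) (ht : t ∈ Set.Icc (-T) T) :
    0 ≤ triangleWeight T t := by
  rw [triangleWeight, sub_nonneg, div_le_one hT]
  exact abs_le.mpr ht

lemma triangleWeight_le_one {T t : ℝ} (hT : 0 < T) : triangleWeight T t ≤ 1 := by
  rw [triangleWeight]
  linarith [div_nonneg (abs_nonneg t) hT.le]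

lemma continuous_triangleFourier_integrand (T : ℝ) {f : ℝ → ℂ} (hf : Continuous f) (x : ℝ) :
    Continuous fun t : ℝ =>
      (triangleWeight T t : ℂ) * f t * Complex.exp (x * t * Complex.I) := by
  have := continuous_triangleWeight T
  fun_prop

lemma triangleFourier_ofReal (T : ℝ) {f : ℝ → ℝ} (hf : Continuous f) (x : ℝ) :
    triangleFourier T (fun t => (f t : ℂ)) x =
      ∫ t in -T..T, triangleWeight T t * f t * Real.cos (x * t) := by
  have hc := continuous_triangleFourier_integrand T (f := fun t => (f t : ℂ)) (by fun_prop) x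
  have := Complex.reCLM.intervalIntegral_comp_comm (hc.intervalIntegrable (μ := MeasureTheory.volume) (-T) T)
  rw [triangleFourier, ← Complex.reCLM_apply, ← this]
  refine intervalIntegral.integral_congr fun t _ => ?_
  simp only [Complex.reCLM_apply]
  rw [← Complex.ofReal_mul, ← Complex.ofReal_mul, Complex.re_ofReal_mul,
    Complex.exp_ofReal_mul_I_re]

lemma integral_eq_two_mul_of_even {f : ℝ → ℝ} (hf : Continuous f) (h : ∀ t, f (-t) = f t) (T : ℝ) :
    ∫ t in -T..T, f t = 2 * ∫ t in (0 : ℝ)..T, f t := by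
  rw [← intervalIntegral.integral_add_adjacent_intervals (b := 0)
    (hf.intervalIntegrable _ _) (hf.intervalIntegrable _ _), two_mul]
  congr 1
  have := intervalIntegral.integral_comp_neg (a := 0) (b := T) f
  rw [neg_zero] at this
  rw [← this]
  exact intervalIntegral.integral_congr fun t _ => h t

lemma integral_triangleWeight_mul_cos {T : ℝ} (x : ℝ) :
    ∫ t in -T..T, triangleWeight T t * Real.cos (x * t) =
      2 * ∫ t in (0 : ℝ)..T, triangleWeight T t * Real.cos (x * t) := by
  refine integral_eq_two_mul_of_even ?_ (fun t => by simp [triangleWeight]) T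
  have := continuous_triangleWeight T
  fun_prop

lemma integral_triangleWeight_mul_cos_of_ne_zero {T : ℝ} (hT : 0 < T) {x : ℝ} (hx : x ≠ 0) :
    ∫ t in (0 : ℝ)..T, triangleWeight T t * Real.cos (x * t) =
      (1 - Real.cos (x * T)) / (x ^ 2 * T) := by
  have h : ∀ t ∈ Set.uIcc 0 T, HasDerivAt
      (fun t => (1 - t / T) * (Real.sin (x * t) / x) - Real.cos (x * t) / (x ^ 2 * T))
      ((1 - t / T) * Real.cos (x * t)) t := by
    intro t _
    have h1 : HasDerivAt (fun t : ℝ => x * t) x t := by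
      simpa using (hasDerivAt_id t).const_mul x
    have h2 : HasDerivAt (fun t : ℝ => 1 - t / T) (-(1 / T)) t := by
      simpa using ((hasDerivAt_id t).div_const T).const_sub 1
    have h3 := (h2.mul (h1.sin.div_const x)).sub (h1.cos.div_const (x ^ 2 * T))
    refine h3.congr_deriv ?_
    field_simp
    ring
  have e : ∫ t in (0 : ℝ)..T, triangleWeight T t * Real.cos (x * t) =
      ∫ t in (0 : ℝ)..T, (1 - t / T) * Real.cos (x * t) := by
    refine intervalIntegral.integral_congr fun t ht => ?_
    rw [Set.uIcc_of_le hT.le] at ht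
    simp only [triangleWeight, abs_of_nonneg ht.1]
  rw [e, intervalIntegral.integral_eq_sub_of_hasDerivAt h
    ((by fun_prop : Continuous _).intervalIntegrable _ _)]
  field_simp
  simp
  ring

lemma triangleFourier_one_zero {T : ℝ} (hT : 0 < T) :
    triangleFourier T (fun _ => 1) 0 = T := by
  have h := triangleFourier_ofReal T (f := fun _ => 1) continuous_const 0
  simp only [Complex.ofReal_one, mul_one] at h
  rw [h, integral_triangleWeight_mul_cos]
  have e : ∫ t in (0 : ℝ)..T, triangleWeight T t * Real.cos (0 * t) =
      ∫ t in (0 : ℝ)..T, (1 - t / T) := by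
    refine intervalIntegral.integral_congr fun t ht => ?_
    rw [Set.uIcc_of_le hT.le] at ht
    simp [triangleWeight, abs_of_nonneg ht.1]
  rw [e, intervalIntegral.integral_sub (by simp)
    ((by fun_prop : Continuous _).intervalIntegrable _ _), intervalIntegral.integral_div]
  simp
  field_simp
  ring

lemma triangleFourier_one_nonneg {T : ℝ} (hT : 0 < T) (x : ℝ) :
    0 ≤ triangleFourier T (fun _ => 1) x := by
  by_cases hx : x = 0
  · rw [hx, triangleFourier_one_zero hT]; exact hT.le
  have h := triangleFourier_ofReal T (f := fun _ => 1) continuous_const x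
  simp only [Complex.ofReal_one, mul_one] at h
  rw [h, integral_triangleWeight_mul_cos, integral_triangleWeight_mul_cos_of_ne_zero hT hx]
  have := Real.cos_le_one (x * T)
  have h1 : 0 ≤ 1 - Real.cos (x * T) := by linarith
  positivity

lemma exists_abs_triangleFourier_le {T : ℝ} (hT : 0 < T) (f : ℝ → ℂ) :
    ∃ M, ∀ x, |triangleFourier T f x| ≤ M := by
  refine ⟨∫ t in -T..T, ‖(triangleWeight T t : ℂ) * f t‖, fun x => ?_⟩
  refine (Complex.abs_re_le_norm _).trans
    ((intervalIntegral.norm_integral_le_integral_norm (by linarith)).trans (le_of_eq ?_))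
  refine intervalIntegral.integral_congr fun t _ => ?_
  simp only [norm_mul]
  rw [← Complex.ofReal_mul, Complex.norm_exp_ofReal_mul_I, mul_one]

/-- Iteration gives φ(x) ≥ 2^{-n} φ(x + nl) ≥ -2^{-n} M. This yields positivity without expanding
the geometric series under the integral. -/
lemma nonneg_of_half_shift_le {φ : ℝ → ℝ} {M l : ℝ} (hM : ∀ x, |φ x| ≤ M)
    (h : ∀ x, 1 / 2 * φ (x + l) ≤ φ x) (x : ℝ) : 0 ≤ φ x := by
  have h1 : ∀ n : ℕ, ∀ x, (1 / 2) ^ n * (-M) ≤ φ x := by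
    intro n
    induction n with
    | zero => intro x; simpa using (abs_le.mp (hM x)).1
    | succ n ih =>
      intro x
      have := ih (x + l)
      rw [pow_succ]
      linarith [h x]
  have h2 : Filter.Tendsto (fun n : ℕ => (1 / 2 : ℝ) ^ n * (-M)) Filter.atTop (nhds 0) := by
    simpa using (tendsto_pow_atTop_nhds_zero_of_lt_one (r := (1 / 2 : ℝ)) (by norm_num)
      (by norm_num)).mul_const (-M)
  exact le_of_tendsto' h2 fun n => h1 n x

/-- The geometric series `∑_j 2^{-j} e^{i j l t}`. -/
noncomputable def geomFactor (l t : ℝ) : ℂ := (1 - 1 / 2 * Complex.exp (l * t * Complex.I))⁻¹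

lemma one_sub_half_exp_ne_zero (l t : ℝ) : 1 - 1 / 2 * Complex.exp (l * t * Complex.I) ≠ 0 := by
  intro h
  have h1 : ‖(1 : ℂ)‖ = ‖1 / 2 * Complex.exp (l * t * Complex.I)‖ := by
    rw [← sub_eq_zero.mp h]
  rw [norm_mul, ← Complex.ofReal_mul, Complex.norm_exp_ofReal_mul_I] at h1
  norm_num at h1

lemma continuous_geomFactor (l : ℝ) : Continuous (geomFactor l) := by
  unfold geomFactor
  exact Continuous.inv₀ (by fun_prop) (one_sub_half_exp_ne_zero l)

/-- The geometric factor satisfies g = 1 + e^{ilt} g / 2, and multiplication by e^{ilt} translates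
the transform by l. -/
lemma triangleFourier_mul_geomFactor (T : ℝ) {f : ℝ → ℂ} (hf : Continuous f) (l x : ℝ) :
    triangleFourier T (fun t => f t * geomFactor l t) x =
      triangleFourier T f x + 1 / 2 * triangleFourier T (fun t => f t * geomFactor l t) (x + l) := by
  have hg := hf.fun_mul (continuous_geomFactor l)
  have i1 := (continuous_triangleFourier_integrand T hf x).intervalIntegrable
    (μ := MeasureTheory.volume) (-T) T
  have i2 := (continuous_triangleFourier_integrand T hg (x + l)).intervalIntegrable
    (μ := MeasureTheory.volume) (-T) T
  have key : ∫ t in -T..T, (triangleWeight T t : ℂ) * (f t * geomFactor l t) *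
        Complex.exp (x * t * Complex.I) =
      (∫ t in -T..T, (triangleWeight T t : ℂ) * f t * Complex.exp (x * t * Complex.I)) +
      ((1 / 2 : ℝ) : ℂ) * ∫ t in -T..T, (triangleWeight T t : ℂ) * (f t * geomFactor l t) *
        Complex.exp ((x + l : ℝ) * t * Complex.I) := by
    rw [← intervalIntegral.integral_const_mul, ← intervalIntegral.integral_add i1
      (i2.const_mul _)]
    refine intervalIntegral.integral_congr fun t _ => ?_
    have h0 := one_sub_half_exp_ne_zero l t
    have h1 : geomFactor l t = 1 + 1 / 2 * Complex.exp (l * t * Complex.I) * geomFactor l t := by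
      have h := inv_mul_cancel₀ h0
      rw [geomFactor]
      linear_combination h
    have h2 : Complex.exp ((x + l : ℝ) * t * Complex.I) =
        Complex.exp (x * t * Complex.I) * Complex.exp (l * t * Complex.I) := by
      rw [← Complex.exp_add]; congr 1; push_cast; ring
    simp only [h2]
    push_cast
    linear_combination (triangleWeight T t : ℂ) * f t * Complex.exp (x * t * Complex.I) * h1
  simp only [triangleFourier]
  rw [key, Complex.add_re, Complex.re_ofReal_mul]

lemma triangleFourier_mul_geomFactor_nonneg {T : ℝ} (hT : 0 < T) {f : ℝ → ℂ} (hf : Continuous f)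
    (h : ∀ x, 0 ≤ triangleFourier T f x) (l x : ℝ) :
    0 ≤ triangleFourier T (fun t => f t * geomFactor l t) x := by
  obtain ⟨M, hM⟩ := exists_abs_triangleFourier_le hT (fun t => f t * geomFactor l t)
  refine nonneg_of_half_shift_le (l := l) hM (fun x => ?_) x
  rw [triangleFourier_mul_geomFactor T hf l x]
  linarith [h x]

lemma triangleFourier_le_mul_geomFactor {T : ℝ} (hT : 0 < T) {f : ℝ → ℂ} (hf : Continuous f)
    (h : ∀ x, 0 ≤ triangleFourier T f x) (l x : ℝ) :
    triangleFourier T f x ≤ triangleFourier T (fun t => f t * geomFactor l t) x := by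
  rw [triangleFourier_mul_geomFactor T hf l x]
  linarith [triangleFourier_mul_geomFactor_nonneg hT hf h l (x + l)]

/-! ### The resonator and the behaviour of its transform under shifts by log p. -/

/-- The squared absolute value of the resonator `∏_{p ∈ P} (1 - p^{it} / 2)⁻¹`. -/
noncomputable def resonator (P : Finset ℕ) (t : ℝ) : ℝ :=
  ∏ p ∈ P, (5 / 4 - Real.cos (Real.log p * t))⁻¹

lemma quarter_le_five_quarters_sub_cos (x : ℝ) : 1 / 4 ≤ 5 / 4 - Real.cos x := by
  linarith [Real.cos_le_one x]

lemma continuous_resonator (P : Finset ℕ) : Continuous (resonator P) := by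
  unfold resonator
  refine continuous_finsetProd _ fun p _ => Continuous.inv₀ (by fun_prop) fun t => ?_
  have := quarter_le_five_quarters_sub_cos (Real.log p * t)
  linarith

lemma resonator_nonneg (P : Finset ℕ) (t : ℝ) : 0 ≤ resonator P t :=
  Finset.prod_nonneg fun p _ => inv_nonneg.mpr
    (by linarith [quarter_le_five_quarters_sub_cos (Real.log p * t)])

lemma resonator_le (P : Finset ℕ) (t : ℝ) : resonator P t ≤ 4 ^ P.card := by
  rw [resonator, ← Finset.prod_const]
  refine Finset.prod_le_prod (fun p _ => inv_nonneg.mpr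
    (by linarith [quarter_le_five_quarters_sub_cos (Real.log p * t)])) fun p _ => ?_
  have := quarter_le_five_quarters_sub_cos (Real.log p * t)
  rw [inv_le_comm₀ (by linarith) (by norm_num)]
  linarith

lemma ofReal_inv_five_quarters_sub_cos (l t : ℝ) :
    (((5 / 4 - Real.cos (l * t))⁻¹ : ℝ) : ℂ) = geomFactor (-l) t * geomFactor l t := by
  rw [geomFactor, geomFactor, ← mul_inv, Complex.ofReal_inv]
  congr 1
  have h1 : Complex.exp ((-l : ℝ) * t * Complex.I) * Complex.exp (l * t * Complex.I) = 1 := by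
    rw [← Complex.exp_add]
    push_cast
    rw [show (-l * t * Complex.I + l * t * Complex.I : ℂ) = 0 by ring, Complex.exp_zero]
  have h2 : ((Real.cos (l * t) : ℝ) : ℂ) =
      (Complex.exp (l * t * Complex.I) + Complex.exp ((-l : ℝ) * t * Complex.I)) / 2 := by
    push_cast
    rw [Complex.cos]
    congr 3
    ring
  rw [Complex.ofReal_sub, h2]
  push_cast at h1 ⊢
  linear_combination (-1 / 4 : ℂ) * h1

lemma ofReal_resonator_insert {P : Finset ℕ} {p : ℕ} (hp : p ∉ P) (t : ℝ) :
    (resonator (insert p P) t : ℂ) =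
      resonator P t * geomFactor (-Real.log p) t * geomFactor (Real.log p) t := by
  rw [resonator, Finset.prod_insert hp, Complex.ofReal_mul, ofReal_inv_five_quarters_sub_cos,
    resonator]
  ring

/-- Each prime contributes two conjugate geometric factors, and neither can decrease a nonnegative
transform. This gives both F ≥ 0 and, at x = 0, F(0) ≥ T. -/
lemma triangleFourier_one_le_resonator {T : ℝ} (hT : 0 < T) (P : Finset ℕ) (x : ℝ) :
    triangleFourier T (fun _ => 1) x ≤ triangleFourier T (fun t => (resonator P t : ℂ)) x := by
  induction P using Finset.induction_on generalizing x with
  | empty => simp [resonator]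
  | insert p P hp ih =>
    simp_rw [ofReal_resonator_insert hp]
    have hc : Continuous fun t => (resonator P t : ℂ) := by
      have := continuous_resonator P
      fun_prop
    have h0 : ∀ x, 0 ≤ triangleFourier T (fun t => (resonator P t : ℂ)) x :=
      fun x => (triangleFourier_one_nonneg hT x).trans (ih x)
    refine (ih x).trans ((triangleFourier_le_mul_geomFactor hT hc h0 (-Real.log p) x).trans ?_)
    exact triangleFourier_le_mul_geomFactor hT (hc.fun_mul (continuous_geomFactor _))
      (triangleFourier_mul_geomFactor_nonneg hT hc h0 _) _ x

lemma triangleFourier_resonator_nonneg {T : ℝ} (hT : 0 < T) (P : Finset ℕ) (x : ℝ) :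
    0 ≤ triangleFourier T (fun t => (resonator P t : ℂ)) x :=
  (triangleFourier_one_nonneg hT x).trans (triangleFourier_one_le_resonator hT P x)

/-- Split off the factor of p with frequency log p: its functional equation at x - log p writes F(x
- log p) as F(x)/2 plus the transform of the remaining product, which is nonnegative. -/
lemma half_triangleFourier_resonator_le {T : ℝ} (hT : 0 < T) {P : Finset ℕ} {p : ℕ} (hp : p ∈ P)
    (x : ℝ) : 1 / 2 * triangleFourier T (fun t => (resonator P t : ℂ)) x ≤
      triangleFourier T (fun t => (resonator P t : ℂ)) (x - Real.log p) := by
  rw [← Finset.insert_erase hp]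
  simp_rw [ofReal_resonator_insert (Finset.notMem_erase p P)]
  have hc : Continuous fun t => (resonator (P.erase p) t : ℂ) := by
    have := continuous_resonator (P.erase p)
    fun_prop
  have h0 := triangleFourier_mul_geomFactor_nonneg hT hc
    (triangleFourier_resonator_nonneg hT _) (-Real.log p) (x - Real.log p)
  rw [triangleFourier_mul_geomFactor T (hc.fun_mul (continuous_geomFactor (-Real.log p))) (Real.log p)
    (x - Real.log p), sub_add_cancel]
  linarith

lemma half_pow_triangleFourier_resonator_le {T : ℝ} (hT : 0 < T) {P S : Finset ℕ} (hS : S ⊆ P)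
    (hP : ∀ p ∈ P, p ≠ 0) :
    (1 / 2) ^ S.card * triangleFourier T (fun t => (resonator P t : ℂ)) 0 ≤
      triangleFourier T (fun t => (resonator P t : ℂ)) (-Real.log (∏ p ∈ S, p : ℕ)) := by
  induction S using Finset.induction_on with
  | empty => simp
  | insert p S hp ih =>
    have ih' := ih ((Finset.subset_insert p S).trans hS)
    have hpP : p ∈ P := hS (Finset.mem_insert_self p S)
    have h1 := half_triangleFourier_resonator_le hT hpP (-Real.log (∏ p ∈ S, p : ℕ))
    have h2 : -Real.log ((∏ q ∈ insert p S, q : ℕ) : ℝ) =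
        -Real.log (∏ p ∈ S, p : ℕ) - Real.log p := by
      rw [Finset.prod_insert hp, Nat.cast_mul, Real.log_mul (by exact_mod_cast hP p hpP)]
      · ring
      · exact_mod_cast Finset.prod_ne_zero_iff.mpr fun q hq =>
          hP q (hS (Finset.mem_insert_of_mem hq))
    rw [h2, Finset.card_insert_of_notMem hp, pow_succ]
    linarith

/-! ### Choice of the primes and growth estimates. -/

open Filter

lemma eventually_log_le_mul_rpow {c r : ℝ} (hc : 0 < c) (hr : 0 < r) :
    ∀ᶠ x : ℝ in atTop, Real.log x ≤ c * x ^ r := by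
  filter_upwards [(isLittleO_log_rpow_atTop hr).bound hc, eventually_ge_atTop 1] with x hx h1
  have : 0 ≤ x ^ r := by positivity
  rw [Real.norm_of_nonneg (Real.log_nonneg h1), Real.norm_of_nonneg this] at hx
  exact hx

lemma eventually_le_rpow_div_log_rpow {α : ℝ} (h0 : 0 < α) (h1 : α < 1) (B : ℝ) :
    ∀ᶠ x : ℝ in atTop, B ≤ x ^ (1 - α) / Real.log x ^ α := by
  have hB : 0 < |B| + 1 := by positivity
  filter_upwards [eventually_log_le_mul_rpow (c := 1 / (|B| + 1)) (r := 1 - α) (by positivity)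
    (by linarith), Real.tendsto_log_atTop.eventually_ge_atTop 1] with x hx hl
  have h2 : Real.log x ^ α ≤ Real.log x := by
    simpa using Real.rpow_le_rpow_of_exponent_le hl h1.le
  rw [le_div_iff₀ (by positivity)]
  have h3 : (|B| + 1) * Real.log x ≤ x ^ (1 - α) := by
    rw [div_mul_eq_mul_div, one_mul, le_div_iff₀ hB] at hx
    linarith
  have h4 : 0 ≤ Real.log x ^ α := by positivity
  nlinarith [le_abs_self B]

lemma eventually_primeCounting_ge {β : ℝ} (hβ : 0 < β) (hβ1 : β ≤ 1) :
    ∀ᶠ x : ℝ in atTop, β * x / 2 ≤ (Nat.primeCounting ⌊β * x * Real.log x⌋₊ : ℝ) := by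
  have hlog := Real.tendsto_log_atTop
  have hy : Tendsto (fun x : ℝ => β * x * Real.log x) atTop atTop :=
    (tendsto_id.const_mul_atTop hβ).atTop_mul_atTop₀ hlog
  -- Any constant below log 2 would do here; 0.6 is enough because 0.6 / 1.1 > 1/2, where 1.1 log x
  -- bounds log(βx log x).
  have hy' : ∀ᶠ y : ℝ in atTop, 0.6 * y ≤ (y - 1) * Real.log 2 - Real.log (y + 2) := by
    have h1 : ∀ᶠ y : ℝ in atTop, Real.log (y + 2) ≤ 0.01 * (y + 2) ^ (1 : ℝ) :=
      (tendsto_atTop_add_const_right _ 2 tendsto_id).eventually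
        (eventually_log_le_mul_rpow (by norm_num) one_pos)
    filter_upwards [h1, eventually_ge_atTop 100] with y h2 h3
    rw [Real.rpow_one] at h2
    nlinarith [Real.log_two_gt_d9]
  filter_upwards [hy.eventually hy', hy.eventually_gt_atTop 1, hlog.eventually_gt_atTop 0,
    hlog.eventually (eventually_log_le_mul_rpow (c := 0.1) (by norm_num) one_pos),
    eventually_gt_atTop 0] with x h1 h2 h3 h4 h5
  rw [Real.rpow_one] at h4
  refine le_trans ?_ (Chebyshev.pi_ge' h2)
  have hl : Real.log (β * x * Real.log x) ≤ 1.1 * Real.log x := by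
    rw [Real.log_mul (by positivity) (by positivity), Real.log_mul (by positivity) (by positivity)]
    have := Real.log_nonpos hβ.le hβ1
    linarith
  have hl0 : 0 < Real.log (β * x * Real.log x) := Real.log_pos h2
  rw [le_div_iff₀ hl0]
  refine le_trans ?_ h1
  have : 0 < β * x := by positivity
  calc β * x / 2 * Real.log (β * x * Real.log x) ≤ β * x / 2 * (1.1 * Real.log x) := by gcongr
    _ ≤ _ := by nlinarith [mul_pos this h3]

lemma exists_primes_card_eq {n K : ℕ} (h : K ≤ Nat.primeCounting n) :
    ∃ P : Finset ℕ, P.card = K ∧ ∀ p ∈ P, p.Prime ∧ p ≤ n := by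
  rw [← Nat.primesLE_card_eq_primeCounting] at h
  obtain ⟨P, hP, hc⟩ := Finset.exists_subset_card_eq h
  exact ⟨P, hc, fun p hp => by simpa [and_comm, Nat.mem_primesLE] using hP hp⟩

lemma exp_le_one_add_pow {a u : ℝ} {K : ℕ} (ha : 0 ≤ a) (h : u ≤ K * (a / (1 + a))) :
    Real.exp u ≤ (1 + a) ^ K := by
  have h1 : 0 < 1 + a := by linarith
  have h2 := Real.one_sub_inv_le_log_of_pos h1
  have h3 : 1 - (1 + a)⁻¹ = a / (1 + a) := by field_simp; ring
  rw [← Real.exp_log (pow_pos h1 K), Real.log_pow, Real.exp_le_exp]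
  refine h.trans ?_
  rw [← h3]
  gcongr

lemma half_pow_mul_one_add_pow_le_one {a : ℝ} {J K : ℕ} (ha : 0 ≤ a) (h : K * a ≤ J * Real.log 2) :
    (1 / 2) ^ J * (1 + a) ^ K ≤ 1 := by
  have h1 : (1 + a) ^ K ≤ Real.exp (K * a) := by
    rw [Real.exp_nat_mul]
    gcongr
    linarith [Real.add_one_le_exp a]
  have h2 : Real.exp (J * Real.log 2) = 2 ^ J := by
    rw [Real.exp_nat_mul, Real.exp_log (by norm_num)]
  calc (1 / 2 : ℝ) ^ J * (1 + a) ^ K ≤ (1 / 2) ^ J * 2 ^ J := by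
        gcongr
        exact h1.trans (h2 ▸ Real.exp_le_exp.mpr h)
    _ = 1 := by rw [← mul_pow]; norm_num

/-- Here x plays the role of log T. -/
lemma eventually_exists_primes_log_scale {α β : ℝ} (h0 : 0 < α) (h1 : α < 1) (hβ : 0 < β)
    (hβ1 : β ≤ 1) (C : ℝ) :
    ∀ᶠ x : ℝ in atTop, ∃ (P : Finset ℕ) (y : ℝ) (J : ℕ),
      (∀ p ∈ P, p.Prime ∧ (p : ℝ) ≤ y) ∧ 0 < y ∧ y ^ J ≤ Real.exp x ∧
      4 ^ P.card ≤ Real.exp (β * x) ∧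
      Real.exp (β ^ (1 - α) / 6 * (x ^ (1 - α) / Real.log x ^ α)) + C ≤
        (1 + 1 / 2 * y ^ (-α)) ^ P.card -
          (1 / 2) ^ J * (1 + 2 * (1 / 2 * y ^ (-α))) ^ P.card := by
  have hlog := Real.tendsto_log_atTop
  have hbp : 0 < β ^ (1 - α) := by positivity
  have hy : Tendsto (fun x : ℝ => β * x * Real.log x) atTop atTop :=
    (tendsto_id.const_mul_atTop hβ).atTop_mul_atTop₀ hlog
  filter_upwards [eventually_primeCounting_ge hβ hβ1,
    eventually_le_rpow_div_log_rpow h0 h1 ((|C| + 2) * 20 / β ^ (1 - α)),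
    hlog.eventually_ge_atTop 1,
    eventually_log_le_mul_rpow (c := 0.1 / β ^ (1 - α)) (by positivity) h0,
    eventually_log_le_mul_rpow (c := 0.1) (by norm_num) one_pos,
    eventually_ge_atTop (40 / β),
    hy.eventually ((tendsto_rpow_neg_atTop h0).eventually_le_const (u := 0.1) (by norm_num)),
    eventually_ge_atTop 1] with x hpi hX hl1 hl2 hl3 hx40 ha hx1
  have hx0 : 0 < x := one_pos.trans_le hx1
  have hl0 : 0 < Real.log x := one_pos.trans_le hl1
  rw [Real.rpow_one] at hl3
  -- Since log 4 ≤ 2, this size gives 4^K ≤ e^{βx}.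
  set K := ⌊β * x / 2⌋₊ with hK
  set y := β * x * Real.log x with hydef
  have hy0 : 0 < y := by positivity
  -- Since y ≤ x², this gives y^J ≤ e^x, while J still dominates Ka, so that truncation at J primes
  -- costs at most 1.
  set J := ⌊x / (2 * Real.log x)⌋₊ with hJ
  have hKle : (K : ℝ) ≤ β * x / 2 := Nat.floor_le (by positivity)
  have hKge : 0.95 * (β * x / 2) ≤ K := by
    have h2 := Nat.lt_floor_add_one (β * x / 2)
    have h3 : 40 ≤ x * β := (div_le_iff₀ hβ).mp hx40
    linarith
  have hKpi : K ≤ Nat.primeCounting ⌊y⌋₊ := by exact_mod_cast hKle.trans hpi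
  obtain ⟨P, hPc, hP⟩ := exists_primes_card_eq hKpi
  have hJle : (J : ℝ) ≤ x / (2 * Real.log x) := Nat.floor_le (by positivity)
  have hJge : x / (4 * Real.log x) ≤ J := by
    have h2 := Nat.lt_floor_add_one (x / (2 * Real.log x))
    have h3 : 1 ≤ x / (4 * Real.log x) := by
      rw [le_div_iff₀ (by positivity)]
      linarith
    have h4 : x / (2 * Real.log x) = 2 * (x / (4 * Real.log x)) := by field_simp; norm_num
    linarith
  set X := x ^ (1 - α) / Real.log x ^ α with hXdef
  have hX0 : 0 < X := by positivity
  set a := 1 / 2 * y ^ (-α) with hadef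
  have ha0 : 0 ≤ a := by positivity
  have hya : y ^ (-α) = β ^ (-α) * x ^ (-α) * Real.log x ^ (-α) := by
    rw [hydef, Real.mul_rpow (by positivity) hl0.le, Real.mul_rpow hβ.le hx0.le]
  have hKa : β * x / 2 * a = 1 / 4 * β ^ (1 - α) * X := by
    rw [hadef, hya, hXdef, Real.rpow_sub hβ, Real.rpow_sub hx0, Real.rpow_one, Real.rpow_one,
      Real.rpow_neg hβ.le, Real.rpow_neg hx0.le, Real.rpow_neg hl0.le]
    field_simp
    norm_num
  set u := β ^ (1 - α) / 6 * X with hu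
  -- The factor 1.5 is the slack behind the 6 in β: rounding reduces it to 1.3, and e^{1.3u} - e^u ≥
  -- 0.3u then absorbs C and the truncation error.
  have hKa' : β * x / 2 * a = 1.5 * u := by rw [hKa, hu]; ring
  have hu0 : 0 < u := by positivity
  have hfloor : (⌊y⌋₊ : ℝ) ≤ y := Nat.floor_le hy0.le
  refine ⟨P, y, J, fun p hp => ⟨(hP p hp).1, le_trans (by exact_mod_cast (hP p hp).2) hfloor⟩,
    hy0, ?_, ?_, ?_⟩
  · have hyx : y ≤ Real.exp (2 * Real.log x) := by
      rw [two_mul, Real.exp_add, Real.exp_log hx0, hydef]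
      have : Real.log x ≤ x := by linarith
      calc β * x * Real.log x ≤ 1 * x * x := by gcongr
        _ = x * x := by ring
    calc y ^ J ≤ Real.exp (2 * Real.log x) ^ J := by gcongr
      _ = Real.exp (J * (2 * Real.log x)) := by rw [Real.exp_nat_mul]
      _ ≤ Real.exp x := by
        rw [Real.exp_le_exp]
        exact (le_div_iff₀ (by positivity)).mp hJle
  · rw [hPc, show (4 : ℝ) = Real.exp (Real.log 4) by rw [Real.exp_log (by norm_num)],
      ← Real.exp_nat_mul, Real.exp_le_exp]
    have h4 : Real.log 4 ≤ 2 := by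
      rw [show (4 : ℝ) = 2 ^ 2 by norm_num, Real.log_pow]
      push_cast
      linarith [Real.log_two_lt_d9]
    calc (K : ℝ) * Real.log 4 ≤ β * x / 2 * 2 := by gcongr
      _ = β * x := by ring
  · rw [hPc]
    have hmain : Real.exp (1.3 * u) ≤ (1 + a) ^ K := by
      refine exp_le_one_add_pow ha0 ?_
      have ha1 : a ≤ 0.05 := by rw [hadef]; linarith
      have h5 : a / 1.05 ≤ a / (1 + a) := by gcongr; linarith
      calc 1.3 * u ≤ 0.95 * (1.5 * u) / 1.05 := by rw [le_div_iff₀ (by norm_num)]; linarith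
        _ = 0.95 * (β * x / 2) * (a / 1.05) := by rw [← hKa']; ring
        _ ≤ K * (a / (1 + a)) := by gcongr
    have htail : (1 / 2) ^ J * (1 + 2 * a) ^ K ≤ 1 := by
      refine half_pow_mul_one_add_pow_le_one (by positivity) ?_
      have h6 : (K : ℝ) * (2 * a) ≤ 3 * u := by
        have : (K : ℝ) * a ≤ β * x / 2 * a := by gcongr
        linarith
      have h7 : X * Real.log x ≤ Real.log x * x ^ (1 - α) := by
        rw [hXdef, mul_comm]
        gcongr
        exact div_le_self (by positivity) (Real.one_le_rpow hl1 h0.le)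
      have h8 : β ^ (1 - α) * (X * Real.log x) ≤ 0.1 * x := by
        have h9 : x ^ α * x ^ (1 - α) = x := by
          rw [← Real.rpow_add hx0]; simp
        calc β ^ (1 - α) * (X * Real.log x)
            ≤ β ^ (1 - α) * ((0.1 / β ^ (1 - α) * x ^ α) * x ^ (1 - α)) := by
              refine mul_le_mul_of_nonneg_left (h7.trans ?_) hbp.le
              gcongr
          _ = 0.1 * (x ^ α * x ^ (1 - α)) := by field_simp
          _ = 0.1 * x := by rw [h9]
      have h10 : 3 * u ≤ 0.2 * (x / (4 * Real.log x)) := by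
        rw [mul_div_assoc', le_div_iff₀ (by positivity), hu]
        linear_combination 2 * h8
      calc (K : ℝ) * (2 * a) ≤ 0.2 * (x / (4 * Real.log x)) := h6.trans h10
        _ ≤ J * 0.2 := by rw [mul_comm]; gcongr
        _ ≤ J * Real.log 2 := by
          gcongr
          exact le_trans (by norm_num) Real.log_two_gt_d9.le
    have hbig : (|C| + 2) * 20 / 6 ≤ u := by
      rw [div_le_iff₀ hbp] at hX
      rw [hu]
      linear_combination hX / 6
    have hexp : Real.exp u + 0.3 * u ≤ Real.exp (1.3 * u) := by
      rw [show 1.3 * u = u + 0.3 * u by ring, Real.exp_add]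
      have h12 := Real.add_one_le_exp (0.3 * u)
      calc Real.exp u + 0.3 * u ≤ Real.exp u + Real.exp u * (0.3 * u) := by
            exact add_le_add le_rfl
              (le_mul_of_one_le_left (by positivity) (Real.one_le_exp hu0.le))
        _ = Real.exp u * (0.3 * u + 1) := by ring
        _ ≤ _ := by gcongr
    linear_combination hmain + htail + hexp + 0.3 * hbig + le_abs_self C

lemma eventually_exists_primes {α β : ℝ} (h0 : 0 < α) (h1 : α < 1) (hβ : 0 < β)
    (hβ1 : β ≤ 1) (C : ℝ) :
    ∀ᶠ T : ℝ in atTop, ∃ (P : Finset ℕ) (y : ℝ) (J : ℕ),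
      (∀ p ∈ P, p.Prime ∧ (p : ℝ) ≤ y) ∧ 0 < y ∧ y ^ J ≤ T ∧ 4 ^ P.card ≤ T ^ β ∧
      Real.exp (β ^ (1 - α) / 6 * Real.log T ^ (1 - α) / Real.log (Real.log T) ^ α) + C ≤
        (1 + 1 / 2 * y ^ (-α)) ^ P.card -
          (1 / 2) ^ J * (1 + 2 * (1 / 2 * y ^ (-α))) ^ P.card := by
  filter_upwards [Real.tendsto_log_atTop.eventually
    (eventually_exists_primes_log_scale h0 h1 hβ hβ1 C), eventually_gt_atTop 0] with T h hT
  obtain ⟨P, y, J, hP, hy, hJ, hK, hG⟩ := h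
  refine ⟨P, y, J, hP, hy, by rwa [Real.exp_log hT] at hJ, ?_, ?_⟩
  · rwa [Real.rpow_def_of_pos hT, mul_comm (Real.log T)]
  · rwa [mul_div_assoc]

/-! ### The partial sum tested against the resonator. -/

lemma natCast_cpow_neg_add_mul_I (k : ℕ) (α t : ℝ) :
    ((k + 1 : ℕ) : ℂ) ^ (-((α : ℂ) + t * Complex.I)) =
      (((k + 1 : ℕ) : ℝ) ^ (-α) : ℝ) *
        Complex.exp ((-Real.log (k + 1 : ℕ) : ℝ) * t * Complex.I) := by
  have hk : (0 : ℝ) < ((k + 1 : ℕ) : ℝ) := by positivity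
  have hk' : ((k + 1 : ℕ) : ℂ) ≠ 0 := by exact_mod_cast hk.ne'
  rw [Complex.cpow_def_of_ne_zero hk', Complex.natCast_log.symm, Real.rpow_def_of_pos hk,
    Complex.ofReal_exp, ← Complex.exp_add]
  congr 1
  push_cast
  ring

lemma re_integral_zetaPartialSum (T α : ℝ) (P : Finset ℕ) (N : ℕ) :
    (∫ t in -T..T, ((triangleWeight T t * resonator P t : ℝ) : ℂ) *
      zetaPartialSum N ((α : ℂ) + t * Complex.I)).re =
    ∑ k ∈ Finset.range N, ((k + 1 : ℕ) : ℝ) ^ (-α) *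
      triangleFourier T (fun t => (resonator P t : ℂ)) (-Real.log (k + 1 : ℕ)) := by
  have hc : Continuous fun t => (resonator P t : ℂ) := by
    have := continuous_resonator P
    fun_prop
  have h1 : ∀ t : ℝ, ((triangleWeight T t * resonator P t : ℝ) : ℂ) *
      zetaPartialSum N ((α : ℂ) + t * Complex.I) =
      ∑ k ∈ Finset.range N, (((k + 1 : ℕ) : ℝ) ^ (-α) : ℝ) * ((triangleWeight T t : ℂ) *
        (resonator P t : ℂ) * Complex.exp ((-Real.log (k + 1 : ℕ) : ℝ) * t * Complex.I)) := by
    intro t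
    rw [zetaPartialSum, Finset.mul_sum]
    refine Finset.sum_congr rfl fun k _ => ?_
    rw [natCast_cpow_neg_add_mul_I, Complex.ofReal_mul]
    ring
  simp_rw [h1]
  rw [intervalIntegral.integral_finsetSum fun k _ =>
    ((continuous_triangleFourier_integrand T hc _).intervalIntegrable _ _).const_mul _,
    Complex.re_sum]
  refine Finset.sum_congr rfl fun k _ => ?_
  rw [intervalIntegral.integral_const_mul, Complex.re_ofReal_mul, triangleFourier]

/-- Rankin's trick: the omitted subsets have more than J elements, so weighting them by 2^{|S| - J}
≥ 1 bounds their sum. -/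
lemma sum_filter_card_le_pow {P : Finset ℕ} {a : ℝ} (ha : 0 ≤ a) (J : ℕ) :
    (1 + a) ^ P.card - (1 / 2) ^ J * (1 + 2 * a) ^ P.card ≤
      ∑ S ∈ P.powerset with S.card ≤ J, a ^ S.card := by
  have h1 : ∀ b : ℝ, (1 + b) ^ P.card = ∑ S ∈ P.powerset, b ^ S.card := by
    intro b
    rw [add_comm, ← Finset.sum_pow_mul_eq_add_pow]
    simp
  rw [h1, h1, ← Finset.sum_filter_add_sum_filter_not P.powerset (fun S => S.card ≤ J), sub_le_iff_le_add]
  gcongr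
  calc ∑ S ∈ P.powerset with ¬ S.card ≤ J, a ^ S.card
      ≤ ∑ S ∈ P.powerset with ¬ S.card ≤ J, (1 / 2) ^ J * (2 * a) ^ S.card := by
        refine Finset.sum_le_sum fun S hS => ?_
        have hJ : J ≤ S.card := by
          have := (Finset.mem_filter.mp hS).2
          omega
        rw [mul_pow, ← mul_assoc]
        refine le_mul_of_one_le_left (by positivity) ?_
        calc (1 : ℝ) = (1 / 2) ^ J * 2 ^ J := by rw [← mul_pow]; norm_num
          _ ≤ (1 / 2) ^ J * 2 ^ S.card := by gcongr; norm_num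
    _ ≤ ∑ S ∈ P.powerset, (1 / 2) ^ J * (2 * a) ^ S.card :=
        Finset.sum_le_sum_of_subset_of_nonneg (Finset.filter_subset _ _)
          fun S _ _ => by positivity
    _ = _ := by rw [Finset.mul_sum]

/-- All terms are nonnegative, so it suffices to keep the integers that are products of at most J
distinct primes of P. -/
lemma sum_triangleFourier_resonator_ge {T α y : ℝ} (hT : 0 < T) (hα : 0 ≤ α) {P : Finset ℕ}
    {J N : ℕ} (hy : 0 < y) (hP : ∀ p ∈ P, p.Prime ∧ (p : ℝ) ≤ y) (hJ : ∀ j ≤ J, y ^ j ≤ N) :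
    ((1 + 1 / 2 * y ^ (-α)) ^ P.card - (1 / 2) ^ J * (1 + 2 * (1 / 2 * y ^ (-α))) ^ P.card) *
        triangleFourier T (fun t => (resonator P t : ℂ)) 0 ≤
      ∑ k ∈ Finset.range N, ((k + 1 : ℕ) : ℝ) ^ (-α) *
        triangleFourier T (fun t => (resonator P t : ℂ)) (-Real.log (k + 1 : ℕ)) := by
  set F := triangleFourier T (fun t => (resonator P t : ℂ)) with hF
  have hF0 : ∀ x, 0 ≤ F x := triangleFourier_resonator_nonneg hT P
  let A := P.powerset.filter fun S => S.card ≤ J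
  have hAP : ∀ S ∈ A, S ⊆ P := fun S hS => Finset.mem_powerset.mp (Finset.mem_filter.mp hS).1
  have hpos : ∀ S ∈ A, 0 < ∏ p ∈ S, p := fun S hS =>
    Finset.prod_pos fun p hp => (hP p (hAP S hS hp)).1.pos
  have hle : ∀ S ∈ A, ((∏ p ∈ S, p : ℕ) : ℝ) ≤ y ^ S.card := by
    intro S hS
    rw [Nat.cast_prod, ← Finset.prod_const]
    exact Finset.prod_le_prod (fun p _ => Nat.cast_nonneg p) fun p hp => (hP p (hAP S hS hp)).2
  -- Unique factorization; the shift by 1 appears because the index k stands for the integer k + 1.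
  have hinj : Set.InjOn (fun S : Finset ℕ => ∏ p ∈ S, p - 1) A := by
    intro S hS S' hS' h
    have h1 := hpos S hS
    have h2 := hpos S' hS'
    have h3 : ∏ p ∈ S, p = ∏ p ∈ S', p := by
      simp only at h
      omega
    rw [← Nat.primeFactors_prod fun p hp => (hP p (hAP S hS hp)).1, h3,
      Nat.primeFactors_prod fun p hp => (hP p (hAP S' hS' hp)).1]
  have hsub : A.image (fun S : Finset ℕ => ∏ p ∈ S, p - 1) ⊆ Finset.range N := by
    intro k hk
    obtain ⟨S, hS, rfl⟩ := Finset.mem_image.mp hk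
    have h1 := hpos S hS
    have h2 : ∏ p ∈ S, p ≤ N := by
      exact_mod_cast (hle S hS).trans (hJ _ (Finset.mem_filter.mp hS).2)
    rw [Finset.mem_range]
    omega
  calc _ ≤ (∑ S ∈ A, (1 / 2 * y ^ (-α)) ^ S.card) * F 0 :=
        mul_le_mul_of_nonneg_right (sum_filter_card_le_pow (by positivity) J) (hF0 0)
    _ ≤ ∑ S ∈ A, ((∏ p ∈ S, p : ℕ) : ℝ) ^ (-α) * F (-Real.log (∏ p ∈ S, p : ℕ)) := by
        rw [Finset.sum_mul]
        refine Finset.sum_le_sum fun S hS => ?_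
        have h1 : (y ^ (-α)) ^ S.card ≤ ((∏ p ∈ S, p : ℕ) : ℝ) ^ (-α) := by
          rw [← Real.rpow_natCast, ← Real.rpow_mul hy.le, mul_comm, Real.rpow_mul hy.le,
            Real.rpow_natCast]
          exact Real.rpow_le_rpow_of_nonpos (by exact_mod_cast hpos S hS) (hle S hS) (by linarith)
        have h2 := half_pow_triangleFourier_resonator_le hT (hAP S hS)
          fun p hp => (hP p hp).1.ne_zero
        calc (1 / 2 * y ^ (-α)) ^ S.card * F 0 = (y ^ (-α)) ^ S.card * ((1 / 2) ^ S.card * F 0) := by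
              rw [mul_pow]; ring
          _ ≤ _ := mul_le_mul h1 h2 (mul_nonneg (by positivity) (hF0 0)) (by positivity)
    _ = ∑ k ∈ A.image (fun S : Finset ℕ => ∏ p ∈ S, p - 1), ((k + 1 : ℕ) : ℝ) ^ (-α) *
          F (-Real.log (k + 1 : ℕ)) := by
        rw [Finset.sum_image hinj]
        refine Finset.sum_congr rfl fun S hS => ?_
        rw [Nat.sub_add_cancel (hpos S hS)]
    _ ≤ _ := Finset.sum_le_sum_of_subset_of_nonneg hsub fun k _ _ =>
        mul_nonneg (by positivity) (hF0 _)

/-! ### Lower bound for the first moment of |ζ| against the resonator. -/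

lemma integral_inv_one_add_abs {T : ℝ} (hT : 0 ≤ T) :
    ∫ t in -T..T, (1 + |t|)⁻¹ = 2 * Real.log (1 + T) := by
  have hc : Continuous fun t : ℝ => (1 + |t|)⁻¹ :=
    Continuous.inv₀ (by fun_prop) fun t => by positivity
  rw [integral_eq_two_mul_of_even hc (fun t => by simp)]
  congr 1
  have h : ∀ t ∈ Set.uIcc 0 T, HasDerivAt (fun t => Real.log (1 + t)) ((1 + |t|)⁻¹) t := by
    intro t ht
    rw [Set.uIcc_of_le hT] at ht
    have h1 : HasDerivAt (fun t : ℝ => 1 + t) 1 t := (hasDerivAt_id t).const_add 1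
    refine (h1.log (by linarith [ht.1])).congr_deriv ?_
    rw [abs_of_nonneg ht.1, one_div]
  rw [intervalIntegral.integral_eq_sub_of_hasDerivAt h (hc.intervalIntegrable _ _)]
  simp

lemma norm_zeta_sub_partialSum_sub_pole_le {α T t : ℝ} {N : ℕ} (hα : 1 / 2 < α) (hα1 : α < 1)
    (hT : 1 ≤ T) (ht : |t| ≤ T) (hN : T ^ 2 ≤ N) :
    ‖riemannZeta ((α : ℂ) + t * Complex.I) - zetaPartialSum N ((α : ℂ) + t * Complex.I) -
      (N : ℂ) ^ (1 - ((α : ℂ) + t * Complex.I)) / ((α : ℂ) + t * Complex.I - 1)‖ ≤ 16 := by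
  set s : ℂ := (α : ℂ) + t * Complex.I with hs
  have hre : s.re = α := by simp [hs]
  have hT0 : 0 < T := by linarith
  have hN1 : 1 ≤ N := by
    have : (1 : ℝ) ≤ N := le_trans (by nlinarith) hN
    exact_mod_cast this
  have hs1 : s ≠ 1 := by
    intro h
    rw [h, Complex.one_re] at hre
    linarith
  refine (norm_riemannZeta_sub_zetaPartialSum_le hN1 (by linarith) (by linarith) hs1).trans ?_
  rw [hre]
  have h1 : ‖s‖ ≤ 2 * T := by
    have : ‖s‖ ≤ ‖(α : ℂ)‖ + ‖(t : ℂ) * Complex.I‖ := norm_add_le _ _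
    simp only [Complex.norm_real, norm_mul, Complex.norm_I, mul_one, Real.norm_eq_abs] at this
    rw [abs_of_pos (by linarith)] at this
    linarith
  have h2 : (N : ℝ) ^ (-α) ≤ T⁻¹ := by
    calc (N : ℝ) ^ (-α) ≤ (T ^ 2) ^ (-α) :=
          Real.rpow_le_rpow_of_nonpos (by positivity) hN (by linarith)
      _ = T ^ (-(2 * α)) := by
          rw [← Real.rpow_natCast, ← Real.rpow_mul hT0.le]
          congr 1; push_cast; ring
      _ ≤ T ^ (-1 : ℝ) := Real.rpow_le_rpow_of_exponent_le hT (by linarith)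
      _ = T⁻¹ := Real.rpow_neg_one T
  have h3 : 4 / α ≤ 8 := by rw [div_le_iff₀ (by linarith)]; linarith
  calc 4 / α * ‖s‖ * (N : ℝ) ^ (-α) ≤ 8 * (2 * T) * T⁻¹ := by gcongr
    _ = 16 := by field_simp; norm_num

/-- The decay in t is essential: integrated over [-T, T] the pole term costs only a logarithm rather
than a factor T. -/
lemma norm_pole_term_le {α : ℝ} (hα1 : α < 1) {N : ℕ} (hN : 1 ≤ N) (hα0 : 0 < α) (t : ℝ) :
    ‖(N : ℂ) ^ (1 - ((α : ℂ) + t * Complex.I)) / ((α : ℂ) + t * Complex.I - 1)‖ ≤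
      (N : ℝ) ^ (1 - α) * (2 / (1 - α)) * (1 + |t|)⁻¹ := by
  set s : ℂ := (α : ℂ) + t * Complex.I with hs
  have h1 : 1 - α ≤ ‖s - 1‖ := by
    have := Complex.abs_re_le_norm (s - 1)
    simp only [hs, Complex.sub_re, Complex.add_re, Complex.ofReal_re, Complex.mul_re,
      Complex.I_re, mul_zero, Complex.ofReal_im, Complex.I_im, zero_mul, sub_zero, add_zero,
      Complex.one_re] at this
    exact le_trans (by rw [abs_sub_comm]; exact le_abs_self _) this
  have h2 : |t| ≤ ‖s - 1‖ := by
    have := Complex.abs_im_le_norm (s - 1)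
    simpa [hs] using this
  have h3 : (1 - α) / 2 * (1 + |t|) ≤ ‖s - 1‖ := by
    have : (1 - α) * |t| ≤ 1 * |t| := by gcongr; linarith
    linarith
  have h4 : 0 < 1 - α := by linarith
  rw [norm_div, Complex.norm_natCast_cpow_of_pos (by omega)]
  have hre : (1 - s).re = 1 - α := by simp [hs]
  rw [hre, mul_assoc, div_eq_mul_inv]
  gcongr
  calc ‖s - 1‖⁻¹ ≤ ((1 - α) / 2 * (1 + |t|))⁻¹ := by gcongr
    _ = _ := by rw [mul_inv, inv_div]

/-- A crude pointwise bound, of size T^{2-2α} when N ≈ T²; it is the source of the exponent 2α - 1.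
-/
lemma norm_riemannZeta_le {α T t : ℝ} {N : ℕ} (hα : 1 / 2 < α) (hα1 : α < 1)
    (hT : 1 ≤ T) (ht : |t| ≤ T) (hN : T ^ 2 ≤ N) :
    ‖riemannZeta ((α : ℂ) + t * Complex.I)‖ ≤ (16 + 3 / (1 - α)) * (N : ℝ) ^ (1 - α) := by
  have hNr : (1 : ℝ) ≤ N := le_trans (by nlinarith) hN
  have hN1 : 1 ≤ N := by exact_mod_cast hNr
  have h0 : 0 < 1 - α := by linarith
  have h1 := norm_zeta_sub_partialSum_sub_pole_le hα hα1 hT ht hN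
  have h2 := norm_pole_term_le hα1 hN1 (by linarith) t
  have h3 := norm_zetaPartialSum_le (s := (α : ℂ) + t * Complex.I) (by simp; linarith)
    (by simpa using hα1) N
  have hre : ((α : ℂ) + t * Complex.I).re = α := by simp
  rw [hre] at h3
  set s : ℂ := (α : ℂ) + t * Complex.I
  have h4 : ‖riemannZeta s‖ ≤
      ‖riemannZeta s - zetaPartialSum N s - (N : ℂ) ^ (1 - s) / (s - 1)‖ +
        ‖zetaPartialSum N s‖ + ‖(N : ℂ) ^ (1 - s) / (s - 1)‖ := by
    calc ‖riemannZeta s‖ = ‖(riemannZeta s - zetaPartialSum N s - (N : ℂ) ^ (1 - s) / (s - 1)) +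
          zetaPartialSum N s + (N : ℂ) ^ (1 - s) / (s - 1)‖ := by congr 1; ring
      _ ≤ _ := norm_add₃_le
  have h5 : (1 : ℝ) ≤ (N : ℝ) ^ (1 - α) := Real.one_le_rpow hNr h0.le
  have h6 : (N : ℝ) ^ (1 - α) * (2 / (1 - α)) * (1 + |t|)⁻¹ ≤ (N : ℝ) ^ (1 - α) * (2 / (1 - α)) := by
    refine mul_le_of_le_one_right (by positivity) (inv_le_one_of_one_le₀ ?_)
    linarith [abs_nonneg t]
  calc _ ≤ 16 * (N : ℝ) ^ (1 - α) + (N : ℝ) ^ (1 - α) / (1 - α) +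
        (N : ℝ) ^ (1 - α) * (2 / (1 - α)) := by linarith
    _ = _ := by ring

lemma continuous_riemannZeta_vertical {α : ℝ} (hα : α ≠ 1) :
    Continuous fun t : ℝ => riemannZeta ((α : ℂ) + t * Complex.I) := by
  rw [continuous_iff_continuousAt]
  intro t
  have h : (α : ℂ) + t * Complex.I ≠ 1 := by
    intro h
    apply hα
    simpa using congrArg Complex.re h
  exact ContinuousAt.comp (f := fun t : ℝ => (α : ℂ) + t * Complex.I)
    (differentiableAt_riemannZeta h).continuousAt (by fun_prop)

lemma norm_riemannZeta_vertical_neg (α t : ℝ) :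
    ‖riemannZeta ((α : ℂ) + ((-t : ℝ) : ℂ) * Complex.I)‖ =
      ‖riemannZeta ((α : ℂ) + t * Complex.I)‖ := by
  rw [← Complex.norm_conj (riemannZeta ((α : ℂ) + t * Complex.I)), ← riemannZeta_conj]
  congr 2
  simp

/-- The first moment of `|ζ|` against the resonator is large. -/
lemma integral_norm_zeta_mul_resonator_ge {α T y : ℝ} (hα : 1 / 2 < α) (hα1 : α < 1) (hT : 1 ≤ T)
    {P : Finset ℕ} {J N : ℕ} (hN : T ^ 2 ≤ N) (hy : 0 < y)
    (hP : ∀ p ∈ P, p.Prime ∧ (p : ℝ) ≤ y) (hJ : ∀ j ≤ J, y ^ j ≤ N) :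
    ((1 + 1 / 2 * y ^ (-α)) ^ P.card - (1 / 2) ^ J * (1 + 2 * (1 / 2 * y ^ (-α))) ^ P.card) *
        (∫ t in -T..T, triangleWeight T t * resonator P t) ≤
      (∫ t in -T..T, triangleWeight T t * resonator P t *
        ‖riemannZeta ((α : ℂ) + t * Complex.I)‖) +
      16 * (∫ t in -T..T, triangleWeight T t * resonator P t) +
      4 ^ P.card * ((N : ℝ) ^ (1 - α) * (2 / (1 - α))) * (2 * Real.log (1 + T)) := by
  have hT0 : 0 < T := by linarith
  have hNr : (1 : ℝ) ≤ N := le_trans (by nlinarith) hN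
  have hN1 : 1 ≤ N := by exact_mod_cast hNr
  have h1α : 0 < 1 - α := by linarith
  have hI0 : triangleFourier T (fun t => (resonator P t : ℂ)) 0 =
      ∫ t in -T..T, triangleWeight T t * resonator P t := by
    rw [triangleFourier_ofReal T (continuous_resonator P)]
    simp
  have hcw : Continuous fun t => triangleWeight T t * resonator P t :=
    (continuous_triangleWeight T).mul (continuous_resonator P)
  have hcz := (continuous_riemannZeta_vertical (α := α) (by linarith)).norm
  have hci : Continuous fun t : ℝ => (1 + |t|)⁻¹ :=
    Continuous.inv₀ (by fun_prop) fun t => by positivity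
  have hcD : Continuous fun t : ℝ => zetaPartialSum N ((α : ℂ) + t * Complex.I) :=
    (differentiable_zetaPartialSum N).continuous.comp (by fun_prop)
  set A := 4 ^ P.card * ((N : ℝ) ^ (1 - α) * (2 / (1 - α))) with hA
  have hA0 : 0 ≤ A := by positivity
  have hgain := sum_triangleFourier_resonator_ge hT0 (by linarith : 0 ≤ α) hy hP hJ
  rw [← re_integral_zetaPartialSum, hI0] at hgain
  refine hgain.trans ((Complex.re_le_norm _).trans
    ((intervalIntegral.norm_integral_le_integral_norm (by linarith)).trans ?_))
  rw [← integral_inv_one_add_abs hT0.le, ← intervalIntegral.integral_const_mul,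
    ← intervalIntegral.integral_const_mul, ← intervalIntegral.integral_add
      ((hcw.fun_mul hcz).intervalIntegrable _ _) ((hcw.const_mul 16).intervalIntegrable _ _),
    ← intervalIntegral.integral_add
      (((hcw.fun_mul hcz).fun_add (hcw.const_mul 16)).intervalIntegrable _ _)
      ((hci.const_mul A).intervalIntegrable _ _)]
  refine intervalIntegral.integral_mono_on (by linarith)
    (((Complex.continuous_ofReal.comp hcw).mul hcD).norm.intervalIntegrable _ _)
    (((hcw.fun_mul hcz).fun_add (hcw.const_mul 16)).fun_add (hci.const_mul A) |>.intervalIntegrable _ _)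
    fun t ht => ?_
  have htw := triangleWeight_nonneg hT0 ht
  have hQ := resonator_nonneg P t
  have hw : 0 ≤ triangleWeight T t * resonator P t := mul_nonneg htw hQ
  have hw' : triangleWeight T t * resonator P t ≤ 4 ^ P.card := by
    calc _ ≤ 1 * 4 ^ P.card := mul_le_mul (triangleWeight_le_one hT0) (resonator_le P t) hQ one_pos.le
      _ = _ := one_mul _
  have h1 := norm_zeta_sub_partialSum_sub_pole_le hα hα1 hT (abs_le.mpr ht) hN
  have h2 := norm_pole_term_le hα1 hN1 (by linarith) t
  rw [norm_mul, Complex.norm_real, Real.norm_of_nonneg hw]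
  set s : ℂ := (α : ℂ) + t * Complex.I
  have h3 : ‖zetaPartialSum N s‖ ≤ ‖riemannZeta s‖ +
      ‖riemannZeta s - zetaPartialSum N s - (N : ℂ) ^ (1 - s) / (s - 1)‖ +
        ‖(N : ℂ) ^ (1 - s) / (s - 1)‖ := by
    calc ‖zetaPartialSum N s‖ = ‖riemannZeta s -
          (riemannZeta s - zetaPartialSum N s - (N : ℂ) ^ (1 - s) / (s - 1)) -
          (N : ℂ) ^ (1 - s) / (s - 1)‖ := by congr 1; ring
      _ ≤ _ := (norm_sub_le _ _).trans (add_le_add (norm_sub_le _ _) le_rfl)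
  have h4 : ‖zetaPartialSum N s‖ ≤ ‖riemannZeta s‖ + 16 +
      (N : ℝ) ^ (1 - α) * (2 / (1 - α)) * (1 + |t|)⁻¹ := by linarith
  calc triangleWeight T t * resonator P t * ‖zetaPartialSum N s‖
      ≤ triangleWeight T t * resonator P t * (‖riemannZeta s‖ + 16 +
        (N : ℝ) ^ (1 - α) * (2 / (1 - α)) * (1 + |t|)⁻¹) := by gcongr
    _ = triangleWeight T t * resonator P t * ‖riemannZeta s‖ +
        16 * (triangleWeight T t * resonator P t) + triangleWeight T t * resonator P t *
        ((N : ℝ) ^ (1 - α) * (2 / (1 - α)) * (1 + |t|)⁻¹) := by ring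
    _ ≤ triangleWeight T t * resonator P t * ‖riemannZeta s‖ +
        16 * (triangleWeight T t * resonator P t) + 4 ^ P.card *
        ((N : ℝ) ^ (1 - α) * (2 / (1 - α)) * (1 + |t|)⁻¹) := by gcongr
    _ = _ := by rw [hA]; ring

/-! ### Upper bound for the first moment by the measure of the large values. -/

lemma isClosed_zetaLargeSet {α : ℝ} (hα : α ≠ 1) (τ T : ℝ) : IsClosed (zetaLargeSet α τ T) :=
  isClosed_Icc.inter
    (isClosed_le continuous_const (continuous_riemannZeta_vertical hα).norm)

lemma volume_zetaLargeSet_ne_top (α τ T : ℝ) : MeasureTheory.volume (zetaLargeSet α τ T) ≠ ⊤ :=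
  ne_top_of_le_ne_top (by simp) (MeasureTheory.measure_mono (t := Set.Icc 0 T) fun _ h => h.1)

/-- The first moment of `|ζ|` against the resonator is controlled by the measure of the set of
large values of `ζ`. -/
lemma integral_norm_zeta_mul_resonator_le {α τ T : ℝ} (hα : 1 / 2 < α) (hα1 : α < 1) (hT : 1 ≤ T)
    (P : Finset ℕ) {N : ℕ} (hN : T ^ 2 ≤ N) :
    (∫ t in -T..T, triangleWeight T t * resonator P t *
        ‖riemannZeta ((α : ℂ) + t * Complex.I)‖) ≤
      Real.exp (τ * Real.log T ^ (1 - α) / Real.log (Real.log T) ^ α) *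
        (∫ t in -T..T, triangleWeight T t * resonator P t) +
      4 ^ P.card * ((16 + 3 / (1 - α)) * (N : ℝ) ^ (1 - α)) *
        (2 * MeasureTheory.volume.real (zetaLargeSet α τ T)) := by
  have hT0 : 0 < T := by linarith
  have h1α : 0 < 1 - α := by linarith
  set V := Real.exp (τ * Real.log T ^ (1 - α) / Real.log (Real.log T) ^ α) with hV
  set c := 4 ^ P.card * ((16 + 3 / (1 - α)) * (N : ℝ) ^ (1 - α)) with hc
  have hc0 : 0 ≤ c := by positivity
  -- The moment runs over [-T, T], so the set is symmetrized; |ζ| is even in t on the vertical line.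
  set E := zetaLargeSet α τ T ∪ -zetaLargeSet α τ T with hE
  have hcl := isClosed_zetaLargeSet (α := α) (by linarith) τ T
  have hEm : MeasurableSet E := hcl.measurableSet.union hcl.measurableSet.neg
  have hEtop : MeasureTheory.volume E ≠ ⊤ := by
    refine ((MeasureTheory.measure_union_lt_top_iff.mpr ⟨?_, ?_⟩)).ne
    · exact (volume_zetaLargeSet_ne_top α τ T).lt_top
    · rw [MeasureTheory.Measure.measure_neg]
      exact (volume_zetaLargeSet_ne_top α τ T).lt_top
  have hEv : MeasureTheory.volume.real E ≤ 2 * MeasureTheory.volume.real (zetaLargeSet α τ T) := by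
    refine (MeasureTheory.measureReal_union_le _ _).trans (le_of_eq ?_)
    rw [two_mul]
    congr 1
    simp only [MeasureTheory.measureReal_def, MeasureTheory.Measure.measure_neg]
  have hcw : Continuous fun t => triangleWeight T t * resonator P t :=
    (continuous_triangleWeight T).mul (continuous_resonator P)
  have hcz := (continuous_riemannZeta_vertical (α := α) (by linarith)).norm
  have hind : MeasureTheory.Integrable (E.indicator fun _ => c) :=
    (MeasureTheory.integrable_indicator_iff hEm).mpr
      (MeasureTheory.integrableOn_const hEtop)
  have hind_le : ∫ t in -T..T, E.indicator (fun _ => c) t ≤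
      c * (2 * MeasureTheory.volume.real (zetaLargeSet α τ T)) := by
    rw [intervalIntegral.integral_of_le (by linarith)]
    refine (MeasureTheory.setIntegral_le_integral hind
      (Eventually.of_forall fun t => Set.indicator_nonneg (fun _ _ => hc0) t)).trans ?_
    rw [MeasureTheory.integral_indicator_const _ hEm, smul_eq_mul, mul_comm]
    gcongr
  have hmain : (∫ t in -T..T, triangleWeight T t * resonator P t *
      ‖riemannZeta ((α : ℂ) + t * Complex.I)‖) ≤
      ∫ t in -T..T, (V * (triangleWeight T t * resonator P t) + E.indicator (fun _ => c) t) := by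
    refine intervalIntegral.integral_mono_on (by linarith)
      ((hcw.mul hcz).intervalIntegrable _ _)
      (((hcw.const_mul V).intervalIntegrable _ _).add hind.intervalIntegrable) fun t ht => ?_
    have htw := triangleWeight_nonneg hT0 ht
    have hQ := resonator_nonneg P t
    have hw : 0 ≤ triangleWeight T t * resonator P t := mul_nonneg htw hQ
    have hw' : triangleWeight T t * resonator P t ≤ 4 ^ P.card := by
      calc _ ≤ 1 * 4 ^ P.card :=
            mul_le_mul (triangleWeight_le_one hT0) (resonator_le P t) hQ one_pos.le
        _ = _ := one_mul _
    by_cases hlarge : V ≤ ‖riemannZeta ((α : ℂ) + t * Complex.I)‖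
    · have htE : t ∈ E := by
        rcases le_total 0 t with h | h
        · exact Or.inl ⟨⟨h, ht.2⟩, hlarge⟩
        · refine Or.inr ⟨⟨by linarith, by linarith [ht.1]⟩, ?_⟩
          rw [norm_riemannZeta_vertical_neg]
          exact hlarge
      rw [Set.indicator_of_mem htE]
      have h1 := norm_riemannZeta_le hα hα1 hT (abs_le.mpr ht) hN
      have h2 : triangleWeight T t * resonator P t * ‖riemannZeta ((α : ℂ) + t * Complex.I)‖ ≤ c :=
        mul_le_mul hw' h1 (norm_nonneg _) (by positivity)
      have h3 : 0 ≤ V * (triangleWeight T t * resonator P t) := mul_nonneg (Real.exp_pos _).le hw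
      linarith
    · have h1 : 0 ≤ E.indicator (fun _ => c) t := Set.indicator_nonneg (fun _ _ => hc0) t
      have h2 : triangleWeight T t * resonator P t * ‖riemannZeta ((α : ℂ) + t * Complex.I)‖ ≤
          V * (triangleWeight T t * resonator P t) := by
        rw [mul_comm]
        gcongr
        exact (not_le.mp hlarge).le
      linarith
  rw [intervalIntegral.integral_add ((hcw.const_mul V).intervalIntegrable _ _)
    hind.intervalIntegrable, intervalIntegral.integral_const_mul] at hmain
  linarith

lemma le_integral_triangleWeight_mul_resonator {T : ℝ} (hT : 0 < T) (P : Finset ℕ) :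
    T ≤ ∫ t in -T..T, triangleWeight T t * resonator P t := by
  have h := triangleFourier_one_le_resonator hT P 0
  rw [triangleFourier_one_zero hT, triangleFourier_ofReal T (continuous_resonator P)] at h
  simpa using h

/-! ### The exponent β and the conclusion. -/

lemma zetaBeta_pos {α τ : ℝ} (hτ : 0 < τ) : 0 < zetaBeta α τ := by
  unfold zetaBeta; positivity

lemma zetaBeta_lt {α τ : ℝ} (hα : α ∈ Set.Ioo (1 / 2 : ℝ) 1) (hτ : 0 < τ)
    (hτ' : τ < (2 * α - 1) ^ (1 - α) / 6) : zetaBeta α τ < 2 * α - 1 := by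
  have h1 : 0 < 1 - α := by linarith [hα.2]
  have h2 : 0 < 2 * α - 1 := by linarith [hα.1]
  calc zetaBeta α τ < ((2 * α - 1) ^ (1 - α)) ^ (1 / (1 - α)) :=
        Real.rpow_lt_rpow (by linarith) (by linarith) (by positivity)
    _ = 2 * α - 1 := by rw [← Real.rpow_mul h2.le, mul_one_div_cancel h1.ne', Real.rpow_one]

lemma zetaBeta_rpow {α τ : ℝ} (hα : α < 1) (hτ : 0 < τ) :
    zetaBeta α τ ^ (1 - α) / 6 = τ := by
  have h1 : 1 - α ≠ 0 := by linarith
  rw [zetaBeta, ← Real.rpow_mul (by linarith), one_div_mul_cancel h1, Real.rpow_one]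
  ring

lemma eventually_mul_log_one_add_le_rpow {c r : ℝ} (hc : 0 < c) (hr : 0 < r) :
    ∀ᶠ T : ℝ in atTop, c * Real.log (1 + T) ≤ T ^ r := by
  filter_upwards [eventually_log_le_mul_rpow (c := 1 / (2 * c)) (by positivity) hr,
    eventually_ge_atTop 2] with T h hT
  have h1 : Real.log (1 + T) ≤ 2 * Real.log T := by
    rw [← Real.log_rpow (by linarith)]
    refine Real.log_le_log (by linarith) ?_
    rw [Real.rpow_two]
    nlinarith
  calc c * Real.log (1 + T) ≤ c * (2 * (1 / (2 * c) * T ^ r)) := by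
        refine mul_le_mul_of_nonneg_left (h1.trans ?_) hc.le
        linarith
    _ = T ^ r := by field_simp

theorem theorem2 (α τ : ℝ) (hα : α ∈ Set.Ioo (1 / 2 : ℝ) 1)
    (hτ : 0 < τ) (hτ' : τ < (2 * α - 1) ^ (1 - α) / 6) :
    0 < 2 * α - 1 - zetaBeta α τ ∧
    ∃ T₀ : ℝ, ∀ T : ℝ, T₀ ≤ T →
      ENNReal.ofReal (T ^ (2 * α - 1 - zetaBeta α τ)) ≤
        MeasureTheory.volume (zetaLargeSet α τ T) := by
  have hα0 : 1 / 2 < α := hα.1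
  have hα1 : α < 1 := hα.2
  have h1α : 0 < 1 - α := by linarith
  have hβ := zetaBeta_pos (α := α) hτ
  have hβlt := zetaBeta_lt hα hτ hτ'
  have hβτ := zetaBeta_rpow hα1 hτ
  set β := zetaBeta α τ
  refine ⟨by linarith, ?_⟩
  rw [← eventually_atTop]
  set c := 16 + 3 / (1 - α) with hcdef
  have hc0 : 0 < c := by positivity
  -- The constant 17 + 4c splits as 16 for the approximation error, 1 for the pole term (at most T ≤
  -- I), and 4c for the excess charged to the large values.
  filter_upwards [eventually_exists_primes (by linarith : 0 < α) hα1 hβ (by linarith) (17 + 4 * c),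
    eventually_mul_log_one_add_le_rpow (c := 8 / (1 - α)) (r := 2 * α - 1 - β) (by positivity)
      (by linarith), eventually_ge_atTop 1] with T hex hlog hT
  obtain ⟨P, y, J, hP, hy, hJ, hK, hG⟩ := hex
  rw [hβτ] at hG
  have hT0 : 0 < T := by linarith
  set N := ⌈T ^ 2⌉₊
  have hN : T ^ 2 ≤ N := Nat.le_ceil _
  have hT2 : T ≤ T ^ 2 := by nlinarith
  have hNle : (N : ℝ) ≤ 2 * T ^ 2 := by
    have := Nat.ceil_lt_add_one (by positivity : 0 ≤ T ^ 2)
    linarith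
  have hNpow : (N : ℝ) ^ (1 - α) ≤ 2 * T ^ (2 - 2 * α) := by
    calc (N : ℝ) ^ (1 - α) ≤ (2 * T ^ 2) ^ (1 - α) := by gcongr
      _ = 2 ^ (1 - α) * T ^ (2 - 2 * α) := by
        rw [Real.mul_rpow (by norm_num) (by positivity), ← Real.rpow_natCast,
          ← Real.rpow_mul hT0.le]
        congr 2; push_cast; ring
      _ ≤ 2 ^ (1 : ℝ) * T ^ (2 - 2 * α) := by
        gcongr
        · norm_num
        · linarith
      _ = _ := by rw [Real.rpow_one]
  have hJ' : ∀ j ≤ J, y ^ j ≤ N := by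
    intro j hj
    rcases le_total y 1 with h | h
    · exact (pow_le_one₀ hy.le h).trans (by linarith)
    · exact (pow_le_pow_right₀ h hj).trans (by linarith)
  have hlow := integral_norm_zeta_mul_resonator_ge hα0 hα1 hT hN hy hP hJ'
  have hupp := integral_norm_zeta_mul_resonator_le (τ := τ) hα0 hα1 hT P hN
  have hI := le_integral_triangleWeight_mul_resonator hT0 P
  set I := ∫ t in -T..T, triangleWeight T t * resonator P t
  set v := MeasureTheory.volume.real (zetaLargeSet α τ T) with hv
  have hv0 : 0 ≤ v := MeasureTheory.measureReal_nonneg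
  have hpow : T ^ β * T ^ (2 - 2 * α) * T ^ (2 * α - 1 - β) = T := by
    rw [← Real.rpow_add hT0, ← Real.rpow_add hT0]
    ring_nf
    exact Real.rpow_one T
  -- This is where β < 2α - 1 is needed: T^{β+2-2α} log T must stay below T.
  have hpole : 4 ^ P.card * ((N : ℝ) ^ (1 - α) * (2 / (1 - α))) * (2 * Real.log (1 + T)) ≤ T := by
    have hl : 0 ≤ Real.log (1 + T) := Real.log_nonneg (by linarith)
    calc _ ≤ T ^ β * (2 * T ^ (2 - 2 * α) * (2 / (1 - α))) * (2 * Real.log (1 + T)) := by gcongr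
      _ = T ^ β * T ^ (2 - 2 * α) * (8 / (1 - α) * Real.log (1 + T)) := by ring
      _ ≤ T ^ β * T ^ (2 - 2 * α) * T ^ (2 * α - 1 - β) := by gcongr
      _ = T := hpow
  have hmeas : 4 ^ P.card * (c * (N : ℝ) ^ (1 - α)) * (2 * v) ≤
      4 * c * (T ^ β * T ^ (2 - 2 * α) * v) := by
    calc _ ≤ T ^ β * (c * (2 * T ^ (2 - 2 * α))) * (2 * v) := by gcongr
      _ = _ := by ring
  have hGI := mul_le_mul_of_nonneg_right hG (hT0.le.trans hI)
  have hkey : 4 * c * T ≤ 4 * c * (T ^ β * T ^ (2 - 2 * α) * v) := by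
    have : 4 * c * T ≤ 4 * c * I := by gcongr
    linarith
  have hvT : T ^ (2 * α - 1 - β) ≤ v := by
    have h1 := le_of_mul_le_mul_left hkey (by positivity)
    exact le_of_mul_le_mul_left (hpow.le.trans h1) (by positivity)
  rw [ENNReal.ofReal_le_iff_le_toReal (volume_zetaLargeSet_ne_top α τ T)]
  exact hvT
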